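/- Let $n\ge 0$ and let $(M,g_M)$, $(N,g_N)$ be smooth Riemannian $n$-manifolds without boundary, with $M$ compact and connected. Let $\operatorname{Diff}(M,N)$ be the set of $C^\infty$ diffeomorphisms from $M$ onto $N$, and for $h\in\operatorname{Diff}(M,N)$ let $$\Phi(h)=\int_M\|h^*g_N-g_M\|^2\,\omega_M ,$$ where $\|\cdot\|$ is the fibre norm on $(0,2)$-tensors induced by $g_M^*\otimes g_M^*$ (in coordinates $\|T\|^2=g_M^{ik}g_M^{jl}T_{ij}T_{kl}$) and $\omega_M$ is the Riemannian volume (the volume form of $g_M$ if $M$ is oriented). A diffeomorphism $h$ is called a critical point of $\Phi$ if for every variation of $h$, i.e. every $C^1$ curve $c:(-\varepsilon,\varepsilon)\to\operatorname{Diff}(M,N)$ ($C^\infty$ topology) with $c(0)=h$, the derivative $\frac{d}{dt}\Phi(c(t))\big|_{t=0}$ exists and equals $0$. (i) If $h\in\operatorname{Diff}(M,N)$ satisfies $h^*g_N=R^2g_M$ for some $R\in\mathbb{R}$, then $h$ is a critical point of $\Phi$. (ii) Let $R>0$ and suppose that $M$ and $N$ are embedded smoothly in $\mathbb{R}^{n+1}$,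 that $g_M$ and $g_N$ are the metrics inherited from $\mathbb{R}^{n+1}$, and that $N=h_R(M)$, where $h_R(p)=Rp$. Then $h_R|_M$ belongs to $\operatorname{Diff}(M,N)$ and, for every isometry $f\in\operatorname{Diff}(N,N)$ (that is, $f^*g_N=g_N$), the composition $f\circ h_R|_M$ is a critical point of $\Phi$. -/

import Mathlib

open MeasureTheory Set
open scoped Manifold ContDiff

namespace Deformation

/-- A field of (not necessarily positive) forms of type `(0,2)` on a manifold `M`, given pointwise
by its values on pairs of tangent vectors. -/
abbrev FormField {E H : Type*} [NormedAddCommGroup E] [NormedSpace ℝ E] [TopologicalSpace H]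
    (I : ModelWithCorners ℝ E H) (M : Type*) [TopologicalSpace M] [ChartedSpace H M] :=
  ∀ p : M, TangentSpace I p → TangentSpace I p → ℝ

/-- The pull-back `(h^* T)_p (v, w) = T_{h p} (dh_p v, dh_p w)`. -/
noncomputable def pullback {E H E' H' : Type*}
    [NormedAddCommGroup E] [NormedSpace ℝ E] [TopologicalSpace H]
    [NormedAddCommGroup E'] [NormedSpace ℝ E'] [TopologicalSpace H']
    (I : ModelWithCorners ℝ E H) (J : ModelWithCorners ℝ E' H') {M N : Type*}
    [TopologicalSpace M] [ChartedSpace H M] [TopologicalSpace N] [ChartedSpace H' N]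
    (h : M → N) (T : FormField J N) : FormField I M :=
  fun p v w => T (h p) (mfderiv I J h p v) (mfderiv I J h p w)

/-- The Euclidean metric of `ℝ^m`, as a field of forms. -/
noncomputable def euclideanMetric (m : ℕ) : FormField (𝓡 m) (EuclideanSpace ℝ (Fin m)) :=
  fun _ v w => @inner ℝ (EuclideanSpace ℝ (Fin m)) _ v w

/-- Smooth (`C^∞`) Riemannian metrics on an `n`-manifold without boundary. -/
abbrev SmoothMetric (n : ℕ) (M : Type*) [TopologicalSpace M]
    [ChartedSpace (EuclideanSpace ℝ (Fin n)) M] [IsManifold (𝓡 n) ∞ M] :=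
  Bundle.ContMDiffRiemannianMetric (𝓡 n) ∞ (EuclideanSpace ℝ (Fin n))
    (fun p : M => TangentSpace (𝓡 n) p)

/-- The set of smooth diffeomorphisms `Diff(M, N)`. -/
abbrev Diff (n : ℕ) (M N : Type*) [TopologicalSpace M]
    [ChartedSpace (EuclideanSpace ℝ (Fin n)) M] [TopologicalSpace N]
    [ChartedSpace (EuclideanSpace ℝ (Fin n)) N] :=
  Diffeomorph (𝓡 n) (𝓡 n) M N ∞

section

variable {n : ℕ} {M : Type*} [TopologicalSpace M] [ChartedSpace (EuclideanSpace ℝ (Fin n)) M]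

/-- A Riemannian metric, seen as a field of forms. -/
noncomputable def metricForm [IsManifold (𝓡 n) ∞ M] (g : SmoothMetric n M) : FormField (𝓡 n) M :=
  fun p v w => g.inner p v w

/-- The matrix `(T(b_i, b_j))_{ij}` of a bilinear form on a family of vectors. -/
def gram {ι V : Type*} (b : ι → V) (T : V → V → ℝ) : Matrix ι ι ℝ :=
  Matrix.of fun i j => T (b i) (b j)

/-- The standard basis of `T_pM`, i.e. the coordinate basis of the preferred chart at `p`. -/
noncomputable def stdBasis (p : M) (i : Fin n) : TangentSpace (𝓡 n) p :=
  (EuclideanSpace.single i (1 : ℝ) : EuclideanSpace ℝ (Fin n))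

/-- The square `⟨T, T⟩` of the norm of a `(0,2)`-tensor `T` for the fibre metric `g^* ⊗ g^*`:
in the basis `stdBasis p` of `T_pM` it is `∑ g^{ik} g^{jl} T_{ij} T_{kl}`, with `(g^{ij})` the
inverse matrix of `(g_{ij})`. The value does not depend on the basis. -/
noncomputable def tensorNormSq (g T : FormField (𝓡 n) M) (p : M) : ℝ :=
  let G : Matrix (Fin n) (Fin n) ℝ := (gram (stdBasis p) (g p))⁻¹
  let S : Matrix (Fin n) (Fin n) ℝ := gram (stdBasis p) (T p)
  ∑ i, ∑ j, ∑ k, ∑ l, G i k * G j l * S i j * S k l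

/-- The coordinate vector fields `∂/∂x_i` of the chart `chartAt _ x`, at the point with
coordinates `z`. -/
noncomputable def coordVec (x : M) (z : EuclideanSpace ℝ (Fin n)) (i : Fin n) :
    TangentSpace (𝓡 n) ((chartAt (EuclideanSpace ℝ (Fin n)) x).symm z) :=
  mfderiv (𝓡 n) (𝓡 n) (chartAt (EuclideanSpace ℝ (Fin n)) x).symm z
    (EuclideanSpace.single i (1 : ℝ) : EuclideanSpace ℝ (Fin n))

/-- The density `√(det (g_{ij}))` of the metric `g` in the chart `chartAt _ x`, at the point with
coordinates `z`. -/
noncomputable def volDensity (g : FormField (𝓡 n) M) (x : M) (z : EuclideanSpace ℝ (Fin n)) : ℝ :=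
  √(gram (coordVec x z) (g ((chartAt (EuclideanSpace ℝ (Fin n)) x).symm z))).det

/-- The measure `√(det (g_{ij})) dx_1 ⋯ dx_n` on the domain of the chart `chartAt _ x`, extended
by `0` to the whole of `M`. -/
noncomputable def chartVolume [MeasurableSpace M] (g : FormField (𝓡 n) M) (x : M) : Measure M :=
  (((volume.restrict (chartAt (EuclideanSpace ℝ (Fin n)) x).target).withDensity
    fun z => ENNReal.ofReal (volDensity g x z))).map (chartAt (EuclideanSpace ℝ (Fin n)) x).symm

/-- The Riemannian volume measure. By the change of variables formula the measures
`chartVolume g x` and `chartVolume g y` agree on the intersection of the two chart domains; the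
volume measure is obtained by gluing them, that is, it is the smallest measure that is at least
`chartVolume g x` for all `x` (on a second countable manifold it coincides with `chartVolume g x`
on the domain of the chart at `x`). If `M` is oriented, integration against this measure is
integration against the volume form. -/
noncomputable def volumeMeasure [MeasurableSpace M] (g : FormField (𝓡 n) M) : Measure M :=
  ⨆ x : M, chartVolume g x

variable {N : Type*} [TopologicalSpace N] [ChartedSpace (EuclideanSpace ℝ (Fin n)) N]

/-- The deformation energy `Φ(h) = ∫_M ‖h^* g_N - g_M‖² ω_M`. -/
noncomputable def energy [IsManifold (𝓡 n) ∞ M] [IsManifold (𝓡 n) ∞ N] [MeasurableSpace M]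
    (gM : SmoothMetric n M) (gN : SmoothMetric n N) (h : Diff n M N) : ℝ :=
  ∫ p, tensorNormSq (metricForm gM)
      (fun p v w => pullback (𝓡 n) (𝓡 n) h (metricForm gN) p v w - metricForm gM p v w) p
    ∂(volumeMeasure (metricForm gM))

/-- `c`, restricted to `(-ε, ε)`, is a variation of `h`: a `C^1` curve in `Diff(M, N)` (for the
`C^∞` topology) with `c 0 = h`. Explicitly: `(t, p) ↦ c t p` is continuous, and in local
coordinates all the derivatives of `c t` of any order `k` with respect to the space variable are
of class `C^1` in the time and space variables together. -/
def IsVariation (h : Diff n M N) (ε : ℝ) (c : ℝ → Diff n M N) : Prop :=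
  0 < ε ∧ c 0 = h ∧
  ContinuousOn (fun q : ℝ × M => c q.1 q.2) (Ioo (-ε) ε ×ˢ univ) ∧
  ∀ t₀ ∈ Ioo (-ε) ε, ∀ (p : M) (k : ℕ),
    ContDiffAt ℝ 1
      (fun q : ℝ × EuclideanSpace ℝ (Fin n) =>
        iteratedFDeriv ℝ k
          (fun z : EuclideanSpace ℝ (Fin n) =>
            chartAt (EuclideanSpace ℝ (Fin n)) (c t₀ p)
              (c q.1 ((chartAt (EuclideanSpace ℝ (Fin n)) p).symm z)))
          q.2)
      (t₀, chartAt (EuclideanSpace ℝ (Fin n)) p p)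

/-- `h` is a critical point of `Φ` on `Diff(M, N)`: along every variation `c` of `h`, the
derivative of `Φ(c t)` at `t = 0` exists and vanishes. -/
def IsCriticalPoint [IsManifold (𝓡 n) ∞ M] [IsManifold (𝓡 n) ∞ N] [MeasurableSpace M]
    (gM : SmoothMetric n M) (gN : SmoothMetric n N) (h : Diff n M N) : Prop :=
  ∀ (ε : ℝ) (c : ℝ → Diff n M N), IsVariation h ε c →
    HasDerivAt (fun t => energy gM gN (c t)) 0 0

/-- `u : M → ℝ^m` is a smooth isometric embedding of the Riemannian manifold `(M, g)`: a smooth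
embedding for which `g` is the metric inherited from `ℝ^m`. -/
def IsIsometricEmbedding [IsManifold (𝓡 n) ∞ M] {m : ℕ} (g : SmoothMetric n M)
    (u : M → EuclideanSpace ℝ (Fin m)) : Prop :=
  Manifold.IsSmoothEmbedding (𝓡 n) (𝓡 m) ∞ u ∧
    metricForm g = pullback (𝓡 n) (𝓡 m) u (euclideanMetric m)

end

end Deformation

/-!
Let `h` be a diffeomorphism with `h^* g_N = R² g_M` and `R ≠ 0` (the case `R = 0` occurs only in
dimension `0`), and let `c` be a variation of `h`. At a point of `M`, let `G` and `P t` be the Gram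
matrices of `g_M` and `(c t)^* g_N`, so that `P 0 = R² G`. Then the derivative at `t = 0` of
`‖(c t)^* g_N - g_M‖²` is `2 (R² - 1) tr (G⁻¹ P')`, while that of the volume ratio
`√(det P / det G)` is `|R|ⁿ / (2 R²) tr (G⁻¹ P')`: both are multiples of the same trace
(`hasDerivAt_matCalibrated`).
Hence the energy density minus a constant multiple of the volume ratio has vanishing derivative at
every point.

The integral of the volume ratio over `M` is the volume of `N`, whatever the diffeomorphism `c t`
is (`lintegral_volRatio_pullback`). Differentiating under the integral sign therefore gives the
vanishing of the derivative of the energy. In this way the constancy of the volume of `N` takes the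
place of the divergence theorem on `M`.

Three facts make this rigorous. The quantities involved do not depend on the basis of the tangent
space and can be computed in any parametrization (`tensorNormSq_eq_paramGram`,
`volRatio_eq_paramGram`). The volume measure is given by `√(det (g_{ij}))` in every parametrization
(`volumeMeasure_apply_of_subset`), by the change of variables formula in `ℝ^n`. In coordinates the
integrands are of class `C^1` in time and space (`IsVariation.contDiffAt_paramGram_pullback`), so
that on the compact manifold `M` they are Lipschitz in time near `0`, uniformly in space.

For embedded manifolds, the restriction of the homothety of ratio `R` is a diffeomorphism because a
map into an embedded manifold is smooth as soon as it is smooth into the ambient space; it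
multiplies the metric by `R²`, and so does its composition with an isometry.
-/

namespace Deformation

/-! ### Gram matrices -/

section MatrixAlgebra

variable {n : ℕ}

local notation "Mat" => Matrix (Fin n) (Fin n) ℝ

/-- The squared norm `∑ G^{ik} G^{jl} S_{ij} S_{kl}` of the matrix `S` of a `(0,2)`-tensor, for the
Gram matrix `G`. -/
noncomputable def matNormSq (G S : Mat) : ℝ :=
  ∑ i, ∑ j, ∑ k, ∑ l, G⁻¹ i k * G⁻¹ j l * S i j * S k l

theorem matNormSq_eq_trace (G S : Mat) :
    matNormSq G S = ((G⁻¹).transpose * S * G⁻¹ * S.transpose).trace := by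
  simp only [matNormSq, Matrix.trace, Matrix.diag, Matrix.mul_apply, Matrix.transpose_apply,
    Finset.sum_mul]
  have : ∀ i : Fin n, ∑ j, ∑ k, ∑ l, G⁻¹ i k * G⁻¹ j l * S i j * S k l =
      ∑ k, ∑ l, ∑ j, G⁻¹ i k * G⁻¹ j l * S i j * S k l := fun i => by
    rw [Finset.sum_comm]
    exact Finset.sum_congr rfl fun k _ => Finset.sum_comm
  simp only [this]
  rw [Finset.sum_comm]
  refine Finset.sum_congr rfl fun k _ => ?_
  rw [Finset.sum_comm]
  refine Finset.sum_congr rfl fun l _ => ?_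
  rw [Finset.sum_comm]
  refine Finset.sum_congr rfl fun j _ => Finset.sum_congr rfl fun i _ => ?_
  ring

/-- The squared norm of a tensor does not depend on the basis. -/
theorem matNormSq_congr_basis (G S A : Mat) (hA : IsUnit A.det) :
    matNormSq (A.transpose * G * A) (A.transpose * S * A) = matNormSq G S := by
  have h1 : A * A⁻¹ = 1 := Matrix.mul_nonsing_inv A hA
  have h1t : (A⁻¹).transpose * A.transpose = 1 := by
    rw [← Matrix.transpose_mul, h1, Matrix.transpose_one]
  have hinv : (A.transpose * G * A)⁻¹ = A⁻¹ * G⁻¹ * (A⁻¹).transpose := by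
    rw [Matrix.mul_inv_rev, Matrix.mul_inv_rev, Matrix.transpose_nonsing_inv, Matrix.mul_assoc]
  rw [matNormSq_eq_trace, matNormSq_eq_trace, hinv]
  have : (A⁻¹ * G⁻¹ * (A⁻¹).transpose).transpose * (A.transpose * S * A) *
      (A⁻¹ * G⁻¹ * (A⁻¹).transpose) * (A.transpose * S * A).transpose =
      A⁻¹ * ((G⁻¹).transpose * S * G⁻¹ * S.transpose * A) := by
    simp only [Matrix.transpose_mul, Matrix.transpose_transpose]
    calc _ = A⁻¹ * ((G⁻¹).transpose * (((A⁻¹).transpose * A.transpose) * (S * ((A * A⁻¹) *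
          (G⁻¹ * (((A⁻¹).transpose * A.transpose) * (S.transpose * A))))))) := by
          simp only [Matrix.mul_assoc]
      _ = _ := by rw [h1, h1t]; simp only [Matrix.mul_assoc, Matrix.one_mul]
  rw [this, Matrix.trace_mul_comm, Matrix.mul_assoc, h1, Matrix.mul_one]

/-- The ratio of the volume densities of two Gram matrices. -/
noncomputable def matVolRatio (G P : Mat) : ℝ := √(P.det / G.det)

theorem matVolRatio_congr_basis (G P A : Mat) (hA : IsUnit A.det) :
    matVolRatio (A.transpose * G * A) (A.transpose * P * A) = matVolRatio G P := by
  have h : A.det ≠ 0 := hA.ne_zero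
  unfold matVolRatio
  congr 1
  simp only [Matrix.det_mul, Matrix.det_transpose]
  by_cases hG : G.det = 0
  · simp [hG]
  · field_simp

/-! ### Derivatives of matrix expressions, entry by entry -/

theorem hasDerivAt_matrix_mul {A B : ℝ → Mat} {A' B' : Mat} {t : ℝ}
    (hA : ∀ i j, HasDerivAt (fun s => A s i j) (A' i j) t)
    (hB : ∀ i j, HasDerivAt (fun s => B s i j) (B' i j) t) (i j : Fin n) :
    HasDerivAt (fun s => (A s * B s) i j) ((A' * B t + A t * B') i j) t := by
  simp only [Matrix.mul_apply, Matrix.add_apply, ← Finset.sum_add_distrib]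
  exact HasDerivAt.fun_sum fun k _ => (hA i k).mul (hB k j)

/-- The derivative of the determinant at a multiple of the identity matrix is a multiple of the
trace: a nontrivial permutation moves at least two points, so its product has at least two
vanishing factors. -/
theorem hasDerivAt_det_of_eq_smul_one {A : ℝ → Mat} {A' : Mat} {t r : ℝ}
    (hA : ∀ i j, HasDerivAt (fun s => A s i j) (A' i j) t) (h0 : A t = r • (1 : Mat)) :
    HasDerivAt (fun s => (A s).det) (r ^ (n - 1) * A'.trace) t := by
  have key : HasDerivAt (fun s => ∑ σ : Equiv.Perm (Fin n),
      ((Equiv.Perm.sign σ : ℤ) : ℝ) * ∏ i, A s (σ i) i)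
      (∑ σ : Equiv.Perm (Fin n), ((Equiv.Perm.sign σ : ℤ) : ℝ) *
        ∑ i, (∏ j ∈ Finset.univ.erase i, A t (σ j) j) • A' (σ i) i) t :=
    HasDerivAt.fun_sum fun σ _ =>
      (HasDerivAt.fun_finsetProd fun i _ => hA (σ i) i).const_mul _
  simp only [Matrix.det_apply']
  convert key using 1
  rw [Finset.sum_eq_single (1 : Equiv.Perm (Fin n))]
  · simp only [Equiv.Perm.sign_one, Units.val_one, Int.cast_one, one_mul, Equiv.Perm.one_apply, h0,
      Matrix.smul_apply, Matrix.one_apply_eq, smul_eq_mul, mul_one, Finset.prod_const,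
      Finset.mem_univ, Finset.card_erase_of_mem, Finset.card_univ, Fintype.card_fin,
      Matrix.trace, Matrix.diag, Finset.mul_sum]
  · intro σ _ hσ
    rw [Finset.sum_eq_zero, mul_zero]
    intro i _
    obtain ⟨j, hj⟩ : ∃ j, σ j ≠ j := by
      by_contra! h
      exact hσ (Equiv.ext h)
    have : ∃ k ∈ Finset.univ.erase i, σ k ≠ k := by
      by_cases hji : j = i
      · refine ⟨σ j, ?_, fun h => hj (σ.injective h)⟩
        simpa [← hji] using hj
      · exact ⟨j, by simpa using hji, hj⟩
    obtain ⟨k, hk, hkσ⟩ := this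
    rw [Finset.prod_eq_zero hk, zero_smul]
    simp [h0, Matrix.one_apply_ne hkσ]
  · simp

/-- The combination of the squared norm of `P - G` and of the volume ratio of `P` and `G` that is
stationary at `P = R ^ 2 • G`, for `R ≠ 0`. -/
noncomputable def matCalibrated (R : ℝ) (G P : Mat) : ℝ :=
  matNormSq G (P - G) - 4 * (R ^ 2 - 1) * (R ^ 2 / |R| ^ n) * matVolRatio G P

/-- Both derivatives are multiples of `tr (G⁻¹ P')`, and the constant in the definition of
`matCalibrated` is chosen so that they cancel. -/
theorem hasDerivAt_matCalibrated {R : ℝ} (hR : R ≠ 0) {G : Mat} (hG : 0 < G.det)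
    (hGs : G.transpose = G) {P : ℝ → Mat} {P' : Mat} {t : ℝ}
    (hP : ∀ i j, HasDerivAt (fun s => P s i j) (P' i j) t) (h0 : P t = R ^ 2 • G) :
    HasDerivAt (fun s => matCalibrated R G (P s)) 0 t := by
  have hu : IsUnit G.det := isUnit_iff_ne_zero.2 hG.ne'
  have hGi : G⁻¹ * G = 1 := Matrix.nonsing_inv_mul G hu
  have hGis : (G⁻¹).transpose = G⁻¹ := by rw [Matrix.transpose_nonsing_inv, hGs]
  have hconst : ∀ (C : Mat) (i j : Fin n), HasDerivAt (fun _ : ℝ => C i j) ((0 : Mat) i j) t :=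
    fun C i j => hasDerivAt_const t _
  -- the squared norm
  have hS : ∀ i j, HasDerivAt (fun s => (P s - G) i j) (P' i j) t := fun i j =>
    (hP i j).sub_const _
  have hSt : ∀ i j, HasDerivAt (fun s => (P s - G).transpose i j) (P'.transpose i j) t :=
    fun i j => hS j i
  have h1 := hasDerivAt_matrix_mul (hasDerivAt_matrix_mul (hasDerivAt_matrix_mul
    (hconst (G⁻¹).transpose) hS) (hconst G⁻¹)) hSt
  have hN : HasDerivAt (fun s => matNormSq G (P s - G))
      (2 * (R ^ 2 - 1) * (G⁻¹ * P').trace) t := by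
    simp only [matNormSq_eq_trace]
    have := HasDerivAt.fun_sum (u := Finset.univ) fun i _ => h1 i i
    refine this.congr_deriv ?_
    change Matrix.trace _ = _
    have hSt0 : P t - G = (R ^ 2 - 1) • G := by rw [h0, sub_smul, one_smul]
    rw [hSt0, Matrix.transpose_smul, hGs, hGis]
    simp only [zero_mul, zero_add, Matrix.mul_zero, add_zero, Matrix.mul_smul,
      Matrix.smul_mul, Matrix.trace_add, Matrix.trace_smul, smul_eq_mul, hGi, Matrix.one_mul]
    rw [Matrix.mul_assoc (G⁻¹ * P'), hGi, Matrix.mul_one]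
    have : (G⁻¹ * P'.transpose).trace = (G⁻¹ * P').trace := by
      rw [← Matrix.trace_transpose, Matrix.transpose_mul, Matrix.transpose_transpose, hGis,
        Matrix.trace_mul_comm]
    rw [this]
    ring
  -- the volume ratio
  have h2 := hasDerivAt_matrix_mul (hconst G⁻¹) hP
  have h20 : G⁻¹ * P t = R ^ 2 • (1 : Mat) := by rw [h0, Matrix.mul_smul, hGi]
  have hdet := hasDerivAt_det_of_eq_smul_one h2 h20
  have hdet0 : (G⁻¹ * P t).det = (R ^ 2) ^ n := by
    rw [h20, Matrix.det_smul, Matrix.det_one, Fintype.card_fin, mul_one]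
  have hV : HasDerivAt (fun s => matVolRatio G (P s))
      (((R ^ 2) ^ (n - 1) * (G⁻¹ * P').trace) / (2 * |R| ^ n)) t := by
    have hsq := hdet.sqrt (by rw [hdet0]; positivity)
    rw [hdet0] at hsq
    have e1 : √((R ^ 2) ^ n) = |R| ^ n := by
      rw [← pow_mul, mul_comm, pow_mul, Real.sqrt_sq_eq_abs, abs_pow]
    rw [e1, Matrix.zero_mul, zero_add] at hsq
    refine hsq.congr_of_eventuallyEq (Filter.Eventually.of_forall fun s => ?_)
    change √((P s).det / G.det) = √((G⁻¹ * P s).det)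
    rw [Matrix.det_mul, Matrix.det_nonsing_inv, Ring.inverse_eq_inv', div_eq_inv_mul]
  refine (hN.sub (hV.const_mul (4 * (R ^ 2 - 1) * (R ^ 2 / |R| ^ n)))).congr_deriv ?_
  have hR' : |R| ≠ 0 := abs_ne_zero.2 hR
  rcases Nat.eq_zero_or_pos n with rfl | hn
  · simp [Matrix.trace]
  · have e2 : (R ^ 2) ^ (n - 1) * R ^ 2 = |R| ^ n * |R| ^ n := by
      rw [← pow_succ, Nat.sub_add_cancel hn, ← sq_abs, ← pow_mul, mul_comm 2 n, pow_mul, sq]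
    field_simp
    linear_combination (-(2 * (R ^ 2 - 1) * (G⁻¹ * P').trace * 2)) * e2

/-! ### Continuous differentiability of matrix expressions, entry by entry -/

section ContDiff

variable {X : Type*} [NormedAddCommGroup X] [NormedSpace ℝ X] {m : WithTop ℕ∞} {x : X}

theorem contDiffAt_matrix_det {A : X → Mat} (hA : ∀ i j, ContDiffAt ℝ m (fun y => A y i j) x) :
    ContDiffAt ℝ m (fun y => (A y).det) x := by
  simp only [Matrix.det_apply']
  exact ContDiffAt.sum fun σ _ => contDiffAt_const.mul (contDiffAt_prod fun i _ => hA (σ i) i)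

theorem contDiffAt_matrix_inv {A : X → Mat} (hA : ∀ i j, ContDiffAt ℝ m (fun y => A y i j) x)
    (h0 : (A x).det ≠ 0) (i j : Fin n) : ContDiffAt ℝ m (fun y => (A y)⁻¹ i j) x := by
  simp only [Matrix.inv_def, Ring.inverse_eq_inv', Matrix.smul_apply, smul_eq_mul,
    Matrix.adjugate_apply]
  refine ((contDiffAt_matrix_det hA).inv h0).mul (contDiffAt_matrix_det fun k l => ?_)
  by_cases hk : k = j
  · subst hk
    simpa using contDiffAt_const
  · simpa [Matrix.updateRow_ne hk] using hA k l

theorem contDiffAt_matrix_mul {A B : X → Mat} (hA : ∀ i j, ContDiffAt ℝ m (fun y => A y i j) x)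
    (hB : ∀ i j, ContDiffAt ℝ m (fun y => B y i j) x) (i j : Fin n) :
    ContDiffAt ℝ m (fun y => (A y * B y) i j) x := by
  simp only [Matrix.mul_apply]
  exact ContDiffAt.sum fun k _ => (hA i k).mul (hB k j)

theorem contDiffAt_matrix_sub {A B : X → Mat} (hA : ∀ i j, ContDiffAt ℝ m (fun y => A y i j) x)
    (hB : ∀ i j, ContDiffAt ℝ m (fun y => B y i j) x) (i j : Fin n) :
    ContDiffAt ℝ m (fun y => (A y - B y) i j) x := by
  simp only [Matrix.sub_apply]
  exact (hA i j).sub (hB i j)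

theorem contDiffAt_matNormSq {G S : X → Mat} (hG : ∀ i j, ContDiffAt ℝ m (fun y => G y i j) x)
    (hS : ∀ i j, ContDiffAt ℝ m (fun y => S y i j) x) (h0 : (G x).det ≠ 0) :
    ContDiffAt ℝ m (fun y => matNormSq (G y) (S y)) x := by
  have hi := contDiffAt_matrix_inv hG h0
  exact ContDiffAt.sum fun i _ => ContDiffAt.sum fun j _ => ContDiffAt.sum fun k _ =>
    ContDiffAt.sum fun l _ => (((hi i k).mul (hi j l)).mul (hS i j)).mul (hS k l)

theorem contDiffAt_matVolRatio {G P : X → Mat} (hG : ∀ i j, ContDiffAt ℝ m (fun y => G y i j) x)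
    (hP : ∀ i j, ContDiffAt ℝ m (fun y => P y i j) x) (h0 : 0 < (G x).det)
    (h1 : 0 < (P x).det) : ContDiffAt ℝ m (fun y => matVolRatio (G y) (P y)) x :=
  ((contDiffAt_matrix_det hP).div (contDiffAt_matrix_det hG) h0.ne').sqrt (div_pos h1 h0).ne'

end ContDiff

end MatrixAlgebra

/-! ### Forms in a parametrization -/

section Frames

variable {n : ℕ}

local notation "Eu" => EuclideanSpace ℝ (Fin n)

/-- The matrix of a linear endomorphism of `ℝ^n` in the standard basis. -/
noncomputable def stdMatrix (L : Eu →L[ℝ] Eu) : Matrix (Fin n) (Fin n) ℝ :=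
  Matrix.of fun i j => L (EuclideanSpace.single j (1 : ℝ)) i

theorem sum_smul_single (v : Eu) : ∑ i, v i • (EuclideanSpace.single i (1 : ℝ) : Eu) = v := by
  simpa using (EuclideanSpace.basisFun (Fin n) ℝ).sum_repr v

theorem det_stdMatrix (L : Eu →L[ℝ] Eu) : (stdMatrix L).det = L.det := by
  have : stdMatrix L = LinearMap.toMatrix (EuclideanSpace.basisFun (Fin n) ℝ).toBasis
      (EuclideanSpace.basisFun (Fin n) ℝ).toBasis (L : Eu →ₗ[ℝ] Eu) := by
    ext i j
    simp [stdMatrix, LinearMap.toMatrix_apply]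
  rw [this, LinearMap.det_toMatrix]

theorem gram_eq_of_eq_sum {V : Type*} [AddCommGroup V] [Module ℝ V] (B : V →ₗ[ℝ] V →ₗ[ℝ] ℝ)
    (b c : Fin n → V) (A : Matrix (Fin n) (Fin n) ℝ) (h : ∀ j, c j = ∑ i, A i j • b i) :
    gram c (fun v w => B v w) = A.transpose * gram b (fun v w => B v w) * A := by
  ext i j
  simp only [gram, Matrix.of_apply, Matrix.mul_apply, Matrix.transpose_apply, h, map_sum, map_smul,
    LinearMap.sum_apply, LinearMap.smul_apply, smul_eq_mul, Finset.mul_sum, Finset.sum_mul]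
  refine Finset.sum_congr rfl fun k _ => Finset.sum_congr rfl fun l _ => ?_
  ring

/-- The Gram matrix of a form transforms by the matrix of `L` when a frame `F (e_i)` is replaced by
`F (L e_i)`. -/
theorem gram_comp_eq {V : Type*} [AddCommGroup V] [Module ℝ V] (B : V →ₗ[ℝ] V →ₗ[ℝ] ℝ)
    (F : Eu →ₗ[ℝ] V) (L : Eu →L[ℝ] Eu) :
    gram (fun i => F (L (EuclideanSpace.single i (1 : ℝ)))) (fun v w => B v w) =
      (stdMatrix L).transpose *
        gram (fun i => F (EuclideanSpace.single i (1 : ℝ))) (fun v w => B v w) * stdMatrix L := by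
  refine gram_eq_of_eq_sum B _ _ _ fun j => ?_
  conv_lhs => rw [← sum_smul_single (L (EuclideanSpace.single j (1 : ℝ)))]
  simp [stdMatrix]

/-- The Gram matrix of a scalar product in a linearly independent family has positive
determinant. -/
theorem gram_det_pos {V : Type*} [AddCommGroup V] [Module ℝ V] (B : V →ₗ[ℝ] V →ₗ[ℝ] ℝ)
    (hsymm : ∀ v w, B v w = B w v) (hpos : ∀ v, v ≠ 0 → 0 < B v v) (F : Eu →ₗ[ℝ] V)
    (hF : Function.Injective F) :
    0 < (gram (fun i => F (EuclideanSpace.single i (1 : ℝ))) (fun v w => B v w)).det := by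
  refine Matrix.PosDef.det_pos (Matrix.PosDef.of_dotProduct_mulVec_pos ?_ ?_)
  · ext i j
    simp [gram, hsymm (F (EuclideanSpace.single i 1))]
  · intro x hx
    have h1 : F (WithLp.toLp 2 x) ≠ 0 := fun h => hx <| by
      have := hF (h.trans (map_zero F).symm)
      simpa using congrArg (WithLp.ofLp) this
    have h2 := hpos _ h1
    rw [← sum_smul_single (WithLp.toLp 2 x)] at h2
    refine h2.trans_eq ?_
    simp only [map_sum, map_smul, LinearMap.sum_apply, LinearMap.smul_apply, smul_eq_mul,
      dotProduct, Matrix.mulVec, gram, Matrix.of_apply, Finset.mul_sum, star_trivial]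
    rw [Finset.sum_comm]
    refine Finset.sum_congr rfl fun i _ => Finset.sum_congr rfl fun j _ => ?_
    ring

end Frames

section Coordinates

variable {n : ℕ} {M : Type*} [TopologicalSpace M] [ChartedSpace (EuclideanSpace ℝ (Fin n)) M]

local notation "Eu" => EuclideanSpace ℝ (Fin n)

/-- The values of a field of forms, read in `ℝ^n` through the identification of each tangent space
with the model space. -/
def formAt (T : FormField (𝓡 n) M) (p : M) : Eu → Eu → ℝ := T p

/-- The differential of a map, read in `ℝ^n` through the identification of each tangent space with
the model space. -/
noncomputable def modelDeriv {M' : Type*} [TopologicalSpace M'] [ChartedSpace Eu M']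
    {N' : Type*} [TopologicalSpace N'] [ChartedSpace Eu N'] (f : M' → N') (p : M') : Eu →L[ℝ] Eu :=
  mfderiv (𝓡 n) (𝓡 n) f p

/-- A field of forms all of whose values are bilinear. -/
def IsBilinearField (T : FormField (𝓡 n) M) : Prop :=
  ∀ p, ∃ B : Eu →ₗ[ℝ] Eu →ₗ[ℝ] ℝ, formAt T p = fun v w => B v w

/-- The frame `∂φ/∂x_i` along a parametrization `φ`. -/
noncomputable def paramVec (φ : Eu → M) (z : Eu) (i : Fin n) : TangentSpace (𝓡 n) (φ z) :=
  mfderiv (𝓡 n) (𝓡 n) φ z (EuclideanSpace.single i (1 : ℝ) : Eu)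

/-- The Gram matrix `(g_{ij})` of a field of forms in a parametrization `φ`. -/
noncomputable def paramGram (T : FormField (𝓡 n) M) (φ : Eu → M) (z : Eu) :
    Matrix (Fin n) (Fin n) ℝ :=
  gram (paramVec φ z) (T (φ z))

theorem paramGram_eq_stdBasis {T : FormField (𝓡 n) M} (hT : IsBilinearField T) (φ : Eu → M)
    (z : Eu) :
    paramGram T φ z = (stdMatrix (modelDeriv φ z)).transpose *
      gram (stdBasis (φ z)) (T (φ z)) * stdMatrix (modelDeriv φ z) := by
  obtain ⟨B, hB⟩ := hT (φ z)
  have := gram_comp_eq B LinearMap.id (modelDeriv φ z)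
  rw [← hB] at this
  exact this

/-- If `φ = ψ ∘ u` near `z`, the Gram matrices in the parametrizations `φ` and `ψ` are related by
the Jacobian matrix of `u`. -/
theorem paramGram_eq_of_eventuallyEq {T : FormField (𝓡 n) M} (hT : IsBilinearField T)
    {φ ψ : Eu → M} {u : Eu → Eu} {z : Eu} (h : φ =ᶠ[nhds z] ψ ∘ u)
    (hψ : MDifferentiableAt (𝓡 n) (𝓡 n) ψ (u z)) (hu : DifferentiableAt ℝ u z) :
    paramGram T φ z = (stdMatrix (fderiv ℝ u z)).transpose * paramGram T ψ (u z) *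
      stdMatrix (fderiv ℝ u z) := by
  obtain ⟨B, hB⟩ := hT (ψ (u z))
  have h1 : modelDeriv φ z = (modelDeriv ψ (u z)).comp (fderiv ℝ u z) := by
    have := h.mfderiv_eq.trans (mfderiv_comp z hψ hu.mdifferentiableAt)
    rw [mfderiv_eq_fderiv] at this
    exact this
  have h2 : paramGram T φ z = gram (fun i => modelDeriv ψ (u z)
      (fderiv ℝ u z (EuclideanSpace.single i (1 : ℝ)))) (formAt T (ψ (u z))) := by
    have h3 : formAt T (φ z) = formAt T (ψ (u z)) := congrArg (formAt T) h.eq_of_nhds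
    ext i j
    change formAt T (φ z) (modelDeriv φ z (EuclideanSpace.single i 1))
      (modelDeriv φ z (EuclideanSpace.single j 1)) = _
    rw [h1, h3]
    rfl
  rw [h2]
  have := gram_comp_eq B (modelDeriv ψ (u z)).toLinearMap (fderiv ℝ u z)
  rw [← hB] at this
  exact this

theorem isUnit_det_stdMatrix_of_bijective {L : Eu →L[ℝ] Eu} (hL : Function.Bijective L) :
    IsUnit (stdMatrix L).det := by
  rw [det_stdMatrix]
  exact LinearMap.isUnit_det _ ((Module.End.isUnit_iff _).2 hL)

/-- The squared norm of a tensor may be computed in any parametrization. -/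
theorem tensorNormSq_eq_paramGram {g T : FormField (𝓡 n) M} (hg : IsBilinearField g)
    (hT : IsBilinearField T) {φ : Eu → M} {z : Eu}
    (hφ : Function.Bijective (modelDeriv (n := n) φ z)) :
    tensorNormSq g T (φ z) = matNormSq (paramGram g φ z) (paramGram T φ z) := by
  rw [paramGram_eq_stdBasis hg, paramGram_eq_stdBasis hT,
    matNormSq_congr_basis _ _ _ (isUnit_det_stdMatrix_of_bijective hφ)]
  rfl

/-- The ratio at `p` of the volume densities of `T` and `g`. -/
noncomputable def volRatio (g T : FormField (𝓡 n) M) (p : M) : ℝ :=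
  matVolRatio (gram (stdBasis p) (g p)) (gram (stdBasis p) (T p))

theorem volRatio_nonneg (g T : FormField (𝓡 n) M) (p : M) : 0 ≤ volRatio g T p :=
  Real.sqrt_nonneg _

theorem volRatio_eq_paramGram {g T : FormField (𝓡 n) M} (hg : IsBilinearField g)
    (hT : IsBilinearField T) {φ : Eu → M} {z : Eu}
    (hφ : Function.Bijective (modelDeriv (n := n) φ z)) :
    volRatio g T (φ z) = matVolRatio (paramGram g φ z) (paramGram T φ z) := by
  rw [paramGram_eq_stdBasis hg, paramGram_eq_stdBasis hT,
    matVolRatio_congr_basis _ _ _ (isUnit_det_stdMatrix_of_bijective hφ)]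
  rfl

theorem isBilinearField_metricForm [IsManifold (𝓡 n) ∞ M] (g : SmoothMetric n M) :
    IsBilinearField (metricForm g) := fun p =>
  ⟨LinearMap.mk₂ ℝ (fun v w : Eu => metricForm g p v w)
    (fun v v' w => by
      have := congrArg (fun f => f w) ((g.inner p).map_add v v')
      exact this)
    (fun c v w => by
      have := congrArg (fun f => f w) ((g.inner p).map_smul c v)
      exact this)
    (fun v w w' => (g.inner p v).map_add w w')
    (fun c v w => (g.inner p v).map_smul c w), rfl⟩

variable {N : Type*} [TopologicalSpace N] [ChartedSpace (EuclideanSpace ℝ (Fin n)) N]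

theorem isBilinearField_pullback {T : FormField (𝓡 n) N} (hT : IsBilinearField T) (h : M → N) :
    IsBilinearField (pullback (𝓡 n) (𝓡 n) h T) := fun p => by
  obtain ⟨B, hB⟩ := hT (h p)
  refine ⟨B.compl₁₂ (modelDeriv h p).toLinearMap
    (modelDeriv h p).toLinearMap, ?_⟩
  funext v w
  exact congrFun (congrFun hB _) _

theorem IsBilinearField.sub {S T : FormField (𝓡 n) M} (hS : IsBilinearField S)
    (hT : IsBilinearField T) : IsBilinearField (fun p v w => S p v w - T p v w) := fun p => by
  obtain ⟨A, hA⟩ := hS p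
  obtain ⟨B, hB⟩ := hT p
  refine ⟨A - B, ?_⟩
  funext v w
  exact congrArg₂ (· - ·) (congrFun (congrFun hA v) w) (congrFun (congrFun hB v) w)

theorem paramGram_sub (S T : FormField (𝓡 n) M) (φ : Eu → M) (z : Eu) :
    paramGram (fun p v w => S p v w - T p v w) φ z = paramGram S φ z - paramGram T φ z := rfl

theorem paramGram_pullback {T : FormField (𝓡 n) N} {h : M → N} {φ : Eu → M} {z : Eu}
    (hh : MDifferentiableAt (𝓡 n) (𝓡 n) h (φ z)) (hφ : MDifferentiableAt (𝓡 n) (𝓡 n) φ z) :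
    paramGram (pullback (𝓡 n) (𝓡 n) h T) φ z = paramGram T (h ∘ φ) z := by
  have h1 : modelDeriv (h ∘ φ) z = (modelDeriv h (φ z)).comp (modelDeriv φ z) :=
    mfderiv_comp z hh hφ
  ext i j
  change _ = formAt T (h (φ z)) (modelDeriv (h ∘ φ) z (EuclideanSpace.single i 1))
    (modelDeriv (h ∘ φ) z (EuclideanSpace.single j 1))
  rw [h1]
  rfl

theorem paramGram_metricForm_transpose [IsManifold (𝓡 n) ∞ M] (g : SmoothMetric n M) (φ : Eu → M)
    (z : Eu) : (paramGram (metricForm g) φ z).transpose = paramGram (metricForm g) φ z := by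
  ext i j
  exact g.symm _ _ _

theorem paramGram_metricForm_det_pos [IsManifold (𝓡 n) ∞ M] (g : SmoothMetric n M) {φ : Eu → M}
    {z : Eu} (hφ : Function.Bijective (modelDeriv (n := n) φ z)) :
    0 < (paramGram (metricForm g) φ z).det := by
  obtain ⟨B, hB⟩ := isBilinearField_metricForm g (φ z)
  have hB' : ∀ v w : Eu, B v w = formAt (metricForm g) (φ z) v w := fun v w =>
    (congrFun (congrFun hB v) w).symm
  have := gram_det_pos B (fun v w => by rw [hB', hB']; exact g.symm _ _ _)
    (fun v hv => by rw [hB']; exact g.pos _ _ hv)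
    (modelDeriv φ z).toLinearMap hφ.1
  rw [← hB] at this
  exact this

theorem mdifferentiable_chart_symm [IsManifold (𝓡 n) ∞ M] (x : M) :
    (chartAt Eu x).symm.MDifferentiable (𝓡 n) (𝓡 n) :=
  have : IsManifold (𝓡 n) 1 M := IsManifold.of_le (n := ∞) (by norm_cast)
  (mdifferentiable_chart x).symm

/-- The coefficients of a smooth metric in a chart are smooth. -/
theorem contDiffAt_paramGram_metricForm [IsManifold (𝓡 n) ∞ M] (g : SmoothMetric n M) (x : M)
    {z : Eu} (hz : z ∈ (chartAt Eu x).target) (i j : Fin n) :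
    ContDiffAt ℝ 1 (fun w => paramGram (metricForm g) (chartAt Eu x).symm w i j) z := by
  have : IsManifold (𝓡 n) 1 M := IsManifold.of_le (n := ∞) (by norm_cast)
  set e := trivializationAt Eu (TangentSpace (𝓡 n) (M := M)) x with he
  have hq : (chartAt Eu x).symm z ∈ (chartAt Eu x).source := (chartAt Eu x).map_target hz
  have hqe : (chartAt Eu x).symm z ∈ e.baseSet := by
    rw [he, TangentBundle.trivializationAt_baseSet]; exact hq
  have hs : ∀ k : Fin n, ContMDiffAt (𝓡 n) ((𝓡 n).prod (𝓡 n)) ∞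
      (fun q : M => Bundle.TotalSpace.mk' Eu (E := TangentSpace (𝓡 n) (M := M)) q
        (e.symmL ℝ q (EuclideanSpace.single k (1 : ℝ)))) ((chartAt Eu x).symm z) := fun k => by
    have h1 := e.contMDiffAt_symmL (IB := 𝓡 n) (n := ∞) (𝕜 := ℝ) hqe
    have h2 : ContMDiffAt (𝓡 n) ((𝓡 n).prod (𝓡 n)) ∞
        (fun q : M => Bundle.TotalSpace.mk' Eu (E := Bundle.Trivial M Eu) q
          (EuclideanSpace.single k (1 : ℝ))) ((chartAt Eu x).symm z) :=
      (Bundle.contMDiffAt_section _).2 contMDiffAt_const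
    exact h1.clm_bundle_apply h2
  have hg := (g.contMDiff ((chartAt Eu x).symm z)).clm_bundle_apply₂ (hs i) (hs j)
  have hg2 := ((Bundle.contMDiffAt_section _).1 hg)
  have hc : ContMDiffAt (𝓡 n) (𝓡 n) ∞ (chartAt Eu x).symm z :=
    (contMDiffOn_chart_symm z hz).contMDiffAt ((chartAt Eu x).open_target.mem_nhds hz)
  have hcomp := (hg2.comp z hc).contDiffAt.of_le (m := 1) (by norm_cast)
  refine hcomp.congr_of_eventuallyEq ?_
  filter_upwards [(chartAt Eu x).open_target.mem_nhds hz] with w hw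
  have hw' : (chartAt Eu x).symm w ∈ (chartAt Eu x).source := (chartAt Eu x).map_target hw
  have hL : ∀ v : Eu, (e.symmL ℝ ((chartAt Eu x).symm w) v : Eu) =
      modelDeriv (chartAt Eu x).symm w v := fun v => by
    have h1 := TangentBundle.symmL_trivializationAt (I := 𝓡 n) hw'
    have h2 : extChartAt (𝓡 n) x ((chartAt Eu x).symm w) = w := by
      simpa using (chartAt Eu x).right_inv hw
    rw [h2] at h1
    simp only [modelWithCornersSelf_coe, Set.range_id, mfderivWithin_univ] at h1
    exact congrArg (fun L : Eu →L[ℝ] Eu => L v) h1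
  change formAt (metricForm g) ((chartAt Eu x).symm w) (modelDeriv (chartAt Eu x).symm w _)
    (modelDeriv (chartAt Eu x).symm w _) = _
  rw [← hL, ← hL]
  rfl

theorem bijective_modelDeriv {φ : OpenPartialHomeomorph Eu M} (hφ : φ.MDifferentiable (𝓡 n) (𝓡 n))
    {z : Eu} (hz : z ∈ φ.source) : Function.Bijective (modelDeriv (n := n) φ z) :=
  hφ.mfderiv_bijective hz

theorem continuousAt_sqrt_det_paramGram [IsManifold (𝓡 n) ∞ M] (g : SmoothMetric n M) (x : M)
    {z : Eu} (hz : z ∈ (chartAt Eu x).target) :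
    ContinuousAt (fun w => √(paramGram (metricForm g) (chartAt Eu x).symm w).det) z :=
  (contDiffAt_matrix_det (contDiffAt_paramGram_metricForm g x hz)).continuousAt.sqrt

end Coordinates

/-! ### The Riemannian volume -/

section Volume

variable {n : ℕ} {M : Type*} [TopologicalSpace M] [ChartedSpace (EuclideanSpace ℝ (Fin n)) M]

local notation "Eu" => EuclideanSpace ℝ (Fin n)

theorem measurableSet_source_inter_preimage {X Y : Type*} [TopologicalSpace X] [MeasurableSpace X]
    [OpensMeasurableSpace X] [TopologicalSpace Y] [MeasurableSpace Y] [BorelSpace Y]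
    (φ : OpenPartialHomeomorph X Y) {A : Set Y} (hA : MeasurableSet A) :
    MeasurableSet (φ.source ∩ φ ⁻¹' A) := by
  have h : Measurable (φ.source.domRestrict φ) := φ.continuousOn.domRestrict.measurable
  have := (φ.open_source.measurableSet).subtype_image (h hA)
  convert this using 1
  ext z
  simp [Set.domRestrict, and_comm]

/-- A measure is the sum of its restrictions to the pieces of a countable partition. -/
theorem measure_eq_sum_restrict {X : Type*} [MeasurableSpace X] (μ : Measure X)
    {D : ℕ → Set X} (hD : ∀ k, MeasurableSet (D k))
    (hd : Pairwise (Function.onFun Disjoint D)) (hu : (⋃ k, D k) = univ) :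
    μ = Measure.sum fun k => μ.restrict (D k) := by
  rw [← Measure.restrict_iUnion hd hD, hu, Measure.restrict_univ]

theorem aemeasurable_param {X : Type*} [TopologicalSpace X] [MeasurableSpace X] [BorelSpace X]
    (φ : OpenPartialHomeomorph Eu X) (f : Eu → ENNReal) :
    AEMeasurable φ ((volume.restrict φ.source).withDensity f) :=
  (φ.continuousOn.aemeasurable φ.open_source.measurableSet).mono_ac
    (withDensity_absolutelyContinuous _ _)

variable [MeasurableSpace M]

/-- The measure `√(det (g_{ij})) dx_1 ⋯ dx_n` on the image of a local parametrization `φ`, extended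
by `0` to the whole of `M`. -/
noncomputable def paramVolume (T : FormField (𝓡 n) M) (φ : OpenPartialHomeomorph Eu M) :
    Measure M :=
  ((volume.restrict φ.source).withDensity
    fun z => ENNReal.ofReal √(paramGram T φ z).det).map φ

theorem chartVolume_eq (T : FormField (𝓡 n) M) (x : M) :
    chartVolume T x = paramVolume T (chartAt Eu x).symm := rfl

variable [BorelSpace M]

theorem paramVolume_apply (T : FormField (𝓡 n) M) (φ : OpenPartialHomeomorph Eu M) {A : Set M}
    (hA : MeasurableSet A) :
    paramVolume T φ A = ∫⁻ z in φ.source ∩ φ ⁻¹' A, ENNReal.ofReal √(paramGram T φ z).det := by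
  rw [paramVolume, Measure.map_apply_of_aemeasurable (aemeasurable_param _ _) hA,
    withDensity_apply', Measure.restrict_restrict' φ.open_source.measurableSet, inter_comm]

/-- Two local parametrizations give the same volume on the intersection of their images, by the
change of variables formula for the transition map. -/
theorem paramVolume_congr {T : FormField (𝓡 n) M} (hT : IsBilinearField T)
    {φ ψ : OpenPartialHomeomorph Eu M} (hφ : φ.MDifferentiable (𝓡 n) (𝓡 n))
    (hψ : ψ.MDifferentiable (𝓡 n) (𝓡 n)) {A : Set M} (hA : MeasurableSet A)
    (hAφ : A ⊆ φ.target) (hAψ : A ⊆ ψ.target) : paramVolume T φ A = paramVolume T ψ A := by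
  set S := φ.source ∩ φ ⁻¹' A with hS
  have hSm : MeasurableSet S := measurableSet_source_inter_preimage φ hA
  set τ : Eu → Eu := ψ.symm ∘ φ with hτ
  have hd : ∀ z ∈ S, DifferentiableAt ℝ τ z := fun z hz =>
    ((hψ.mdifferentiableAt_symm (hAψ hz.2)).comp z (hφ.mdifferentiableAt hz.1)).differentiableAt
  have hinj : InjOn τ S := fun z hz w hw h =>
    φ.injOn hz.1 hw.1 (ψ.symm.injOn (hAψ hz.2) (hAψ hw.2) h)
  have himg : τ '' S = ψ.source ∩ ψ ⁻¹' A := by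
    ext w
    constructor
    · rintro ⟨z, hz, rfl⟩
      refine ⟨ψ.map_target (hAψ hz.2), ?_⟩
      simp only [hτ, mem_preimage, Function.comp_apply, ψ.right_inv (hAψ hz.2)]
      exact hz.2
    · rintro ⟨hw, hwA⟩
      refine ⟨φ.symm (ψ w), ⟨φ.map_target (hAφ hwA), ?_⟩, ?_⟩
      · rw [mem_preimage, φ.right_inv (hAφ hwA)]; exact hwA
      · simp [hτ, φ.right_inv (hAφ hwA), ψ.left_inv hw]
  rw [paramVolume_apply T φ hA, paramVolume_apply T ψ hA, ← himg,
    lintegral_image_eq_lintegral_abs_det_fderiv_mul volume hSm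
      (fun z hz => (hd z hz).hasFDerivAt.hasFDerivWithinAt) hinj]
  refine setLIntegral_congr_fun hSm fun z hz => ?_
  have hev : (φ : Eu → M) =ᶠ[nhds z] ψ ∘ τ := by
    filter_upwards [(φ.continuousAt hz.1).preimage_mem_nhds
      (ψ.open_target.mem_nhds (hAψ hz.2))] with w hw
    exact (ψ.right_inv hw).symm
  have h1 := paramGram_eq_of_eventuallyEq hT hev
    (hψ.mdifferentiableAt (ψ.map_target (hAψ hz.2))) (hd z hz)
  have h2 : (paramGram T φ z).det = (fderiv ℝ τ z).det ^ 2 * (paramGram T ψ (τ z)).det := by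
    rw [h1, Matrix.det_mul, Matrix.det_mul, Matrix.det_transpose, det_stdMatrix]
    ring
  rw [h2, Real.sqrt_mul (sq_nonneg _), Real.sqrt_sq_eq_abs, ENNReal.ofReal_mul (abs_nonneg _)]

theorem paramVolume_inter_target (T : FormField (𝓡 n) M) (φ : OpenPartialHomeomorph Eu M)
    {A : Set M} (hA : MeasurableSet A) : paramVolume T φ (A ∩ φ.target) = paramVolume T φ A := by
  rw [paramVolume_apply T φ hA, paramVolume_apply T φ (hA.inter φ.open_target.measurableSet)]
  congr 2
  ext z
  constructor
  · exact fun h => ⟨h.1, h.2.1⟩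
  · exact fun h => ⟨h.1, h.2, φ.map_source h.1⟩

variable (n M) in
/-- A σ-compact manifold is a countable disjoint union of Borel sets, each of them contained in a
chart domain. -/
theorem exists_measurable_partition [SigmaCompactSpace M] [Nonempty M] :
    ∃ (s : ℕ → M) (D : ℕ → Set M), (∀ k, MeasurableSet (D k)) ∧
      Pairwise (Function.onFun Disjoint D) ∧ (⋃ k, D k) = univ ∧
      ∀ k, D k ⊆ (chartAt Eu (s k)).source := by
  obtain ⟨t, htc, ht⟩ := countable_cover_nhds_of_sigmaCompact
    (fun x : M => (chartAt Eu x).open_source.mem_nhds (mem_chart_source Eu x))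
  have hne : t.Nonempty := by
    have h : Classical.arbitrary M ∈ ⋃ x ∈ t, (chartAt Eu x).source := ht ▸ mem_univ _
    obtain ⟨x, hx, -⟩ := mem_iUnion₂.1 h
    exact ⟨x, hx⟩
  obtain ⟨s, rfl⟩ := htc.exists_eq_range hne
  refine ⟨s, disjointed fun k => (chartAt Eu (s k)).source,
    fun k => MeasurableSet.disjointed (fun k => (chartAt Eu (s k)).open_source.measurableSet) k,
    disjoint_disjointed _, ?_, disjointed_subset _⟩
  rw [iUnion_disjointed]
  simpa using ht

variable [IsManifold (𝓡 n) ∞ M]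

/-- On the image of a local parametrization, the Riemannian volume is given by the density
`√(det (g_{ij}))`. -/
theorem volumeMeasure_apply_of_subset [SigmaCompactSpace M] [Nonempty M] {T : FormField (𝓡 n) M}
    (hT : IsBilinearField T) {φ : OpenPartialHomeomorph Eu M} (hφ : φ.MDifferentiable (𝓡 n) (𝓡 n))
    {A : Set M} (hA : MeasurableSet A) (hAφ : A ⊆ φ.target) :
    volumeMeasure T A = paramVolume T φ A := by
  obtain ⟨s, D, hDm, hDd, hDu, hDs⟩ := exists_measurable_partition n M
  have hch : ∀ x : M, (chartAt Eu x).symm.MDifferentiable (𝓡 n) (𝓡 n) := mdifferentiable_chart_symm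
  -- the chart volumes, glued along the partition
  have hvol : volumeMeasure T = Measure.sum fun k => (chartVolume T (s k)).restrict (D k) := by
    refine le_antisymm (iSup_le fun x => ?_) ?_
    · rw [measure_eq_sum_restrict (chartVolume T x) hDm hDd hDu]
      refine Measure.le_iff.2 fun B hB => ?_
      rw [Measure.sum_apply _ hB, Measure.sum_apply _ hB]
      refine ENNReal.tsum_le_tsum fun k => ?_
      rw [Measure.restrict_apply hB, Measure.restrict_apply hB, chartVolume_eq, chartVolume_eq,
        ← paramVolume_inter_target _ _ (hB.inter (hDm k)),
        paramVolume_congr hT (hch x) (hch (s k)) ((hB.inter (hDm k)).inter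
          (chartAt Eu x).symm.open_target.measurableSet) inter_subset_right
          (fun p hp => hDs k hp.1.2)]
      exact measure_mono inter_subset_left
    · conv_rhs => rw [measure_eq_sum_restrict (volumeMeasure T) hDm hDd hDu]
      refine Measure.le_iff.2 fun B hB => ?_
      rw [Measure.sum_apply _ hB, Measure.sum_apply _ hB]
      exact ENNReal.tsum_le_tsum fun k =>
        Measure.restrict_mono le_rfl (le_iSup (fun x => chartVolume T x) (s k)) B
  rw [hvol, measure_eq_sum_restrict (paramVolume T φ) hDm hDd hDu, Measure.sum_apply _ hA,
    Measure.sum_apply _ hA]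
  refine tsum_congr fun k => ?_
  rw [Measure.restrict_apply hA, Measure.restrict_apply hA, chartVolume_eq]
  exact paramVolume_congr hT (hch (s k)) hφ (hA.inter (hDm k)) (fun p hp => hDs k hp.2)
    (fun p hp => hAφ hp.1)

/-- Integration against the Riemannian volume, in a chart. -/
theorem lintegral_volumeMeasure_of_subset [SigmaCompactSpace M] [Nonempty M] (g : SmoothMetric n M)
    (x : M) {A : Set M} (hA : MeasurableSet A) (hAx : A ⊆ (chartAt Eu x).source) {f : M → ENNReal}
    (hf : Measurable f) :
    ∫⁻ p in A, f p ∂volumeMeasure (metricForm g) =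
      ∫⁻ z in (chartAt Eu x).target ∩ (chartAt Eu x).symm ⁻¹' A,
        ENNReal.ofReal √(paramGram (metricForm g) (chartAt Eu x).symm z).det *
          f ((chartAt Eu x).symm z) := by
  set φ := (chartAt Eu x).symm
  have h1 : (volumeMeasure (metricForm g)).restrict A =
      (paramVolume (metricForm g) φ).restrict A := by
    ext B hB
    rw [Measure.restrict_apply hB, Measure.restrict_apply hB]
    exact volumeMeasure_apply_of_subset (isBilinearField_metricForm g)
      (mdifferentiable_chart_symm x) (hB.inter hA) (fun p hp => hAx hp.2)
  have hS : MeasurableSet (φ.source ∩ φ ⁻¹' A) := measurableSet_source_inter_preimage φ hA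
  have hdens : AEMeasurable (fun z => ENNReal.ofReal √(paramGram (metricForm g) φ z).det)
      (volume.restrict (φ.source ∩ φ ⁻¹' A)) :=
    ENNReal.measurable_ofReal.comp_aemeasurable
      ((ContinuousOn.aemeasurable (fun z hz => (continuousAt_sqrt_det_paramGram g x
        hz).continuousWithinAt) φ.open_source.measurableSet).mono_set inter_subset_left)
  have hφm : AEMeasurable φ (volume.restrict (φ.source ∩ φ ⁻¹' A)) :=
    (φ.continuousOn.aemeasurable φ.open_source.measurableSet).mono_set inter_subset_left
  rw [h1, paramVolume, Measure.restrict_map_of_aemeasurable (aemeasurable_param _ _) hA,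
    lintegral_map' hf.aemeasurable ((aemeasurable_param φ _).mono_measure Measure.restrict_le_self),
    restrict_withDensity', Measure.restrict_restrict' φ.open_source.measurableSet,
    inter_comm (φ ⁻¹' A)]
  exact lintegral_withDensity_eq_lintegral_mul₀ hdens (hf.comp_aemeasurable hφm)

instance isFiniteMeasure_volumeMeasure [CompactSpace M] [Nonempty M] (g : SmoothMetric n M) :
    IsFiniteMeasure (volumeMeasure (metricForm g)) := by
  have : IsLocallyFiniteMeasure (volumeMeasure (metricForm g)) := ⟨fun p => by
    set φ := (chartAt Eu p).symm with hφ
    have hz : chartAt Eu p p ∈ (chartAt Eu p).target := mem_chart_target Eu p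
    set d : Eu → ℝ := fun w => √(paramGram (metricForm g) φ w).det with hd
    have hc : ContinuousAt d (chartAt Eu p p) := continuousAt_sqrt_det_paramGram g p hz
    obtain ⟨r, hr, hball⟩ := Metric.eventually_nhds_iff_ball.1
      (hc.eventually_lt_const (lt_add_one _))
    set A : Set M := (chartAt Eu p).source ∩ chartAt Eu p ⁻¹' Metric.ball (chartAt Eu p p) r
      with hA
    have hAo : IsOpen A := (chartAt Eu p).isOpen_inter_preimage Metric.isOpen_ball
    refine ⟨A, hAo.mem_nhds ⟨mem_chart_source Eu p, Metric.mem_ball_self hr⟩, ?_⟩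
    rw [volumeMeasure_apply_of_subset (isBilinearField_metricForm g)
      (mdifferentiable_chart_symm p) hAo.measurableSet inter_subset_left,
      paramVolume_apply _ _ hAo.measurableSet]
    have hsub : φ.source ∩ φ ⁻¹' A ⊆ Metric.ball (chartAt Eu p p) r := fun z hz => by
      have := hz.2.2
      rwa [mem_preimage, hφ, (chartAt Eu p).right_inv hz.1] at this
    calc ∫⁻ z in φ.source ∩ φ ⁻¹' A, ENNReal.ofReal (d z)
        ≤ ∫⁻ z in Metric.ball (chartAt Eu p p) r, ENNReal.ofReal (d z) :=
          lintegral_mono_set hsub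
      _ ≤ ∫⁻ z in Metric.ball (chartAt Eu p p) r, ENNReal.ofReal (d (chartAt Eu p p) + 1) :=
          setLIntegral_mono measurable_const fun z hz => ENNReal.ofReal_le_ofReal (hball z hz).le
      _ < ⊤ := by
          rw [setLIntegral_const]
          exact ENNReal.mul_lt_top ENNReal.ofReal_lt_top measure_ball_lt_top⟩
  exact ⟨isCompact_univ.measure_lt_top⟩

variable {N : Type*} [TopologicalSpace N] [ChartedSpace (EuclideanSpace ℝ (Fin n)) N]
  [IsManifold (𝓡 n) ∞ N] [MeasurableSpace N] [BorelSpace N]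

/-- A diffeomorphism `h` transports the measure with density `√(det (h^* g_N) / det g_M)` to the
Riemannian volume of `N`. -/
theorem lintegral_volRatio_pullback [CompactSpace M] [Nonempty M] (gM : SmoothMetric n M)
    (gN : SmoothMetric n N) (h : Diff n M N)
    (hm : Measurable (volRatio (metricForm gM) (pullback (𝓡 n) (𝓡 n) h (metricForm gN)))) :
    ∫⁻ p, ENNReal.ofReal (volRatio (metricForm gM) (pullback (𝓡 n) (𝓡 n) h (metricForm gN)) p)
      ∂volumeMeasure (metricForm gM) = volumeMeasure (metricForm gN) univ := by
  have : CompactSpace N := h.toHomeomorph.compactSpace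
  have : Nonempty N := ⟨h (Classical.arbitrary M)⟩
  obtain ⟨s, D, hDm, hDd, hDu, hDs⟩ := exists_measurable_partition n M
  have himg : ∀ k, MeasurableSet (h '' D k) := fun k =>
    h.toHomeomorph.measurableEmbedding.measurableSet_image.2 (hDm k)
  have hNu : (⋃ k, h '' D k) = univ := by
    rw [← image_iUnion, hDu, image_univ]
    exact h.surjective.range_eq
  have hNd : Pairwise (Function.onFun Disjoint fun k => h '' D k) := fun i j hij =>
    (disjoint_image_iff h.injective).2 (hDd hij)
  rw [← hNu, measure_iUnion hNd himg,
    measure_eq_sum_restrict (volumeMeasure (metricForm gM)) hDm hDd hDu, lintegral_sum_measure]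
  refine tsum_congr fun k => ?_
  rw [lintegral_volumeMeasure_of_subset gM (s k) (hDm k) (hDs k) hm.ennreal_ofReal]
  set e := chartAt Eu (s k) with he
  -- the chart, transported to `N` by `h`
  set φ : OpenPartialHomeomorph Eu N := e.symm.trans h.toHomeomorph.toOpenPartialHomeomorph with hφ
  have hφs : φ.source = e.target := by simp [hφ]
  have hφm : φ.MDifferentiable (𝓡 n) (𝓡 n) := (mdifferentiable_chart_symm (s k)).trans
    (h.toOpenPartialHomeomorph_mdifferentiable (by simp))
  have hφt : h '' D k ⊆ φ.target := by
    rintro _ ⟨p, hp, rfl⟩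
    have h1 : e p ∈ φ.source := hφs ▸ e.map_source (hDs k hp)
    have h2 : φ (e p) = h p := congrArg h (e.left_inv (hDs k hp))
    exact h2 ▸ φ.map_source h1
  have hpre : φ.source ∩ φ ⁻¹' (h '' D k) = e.target ∩ e.symm ⁻¹' D k := by
    rw [hφs]
    congr 1
    ext z
    exact h.injective.mem_set_image
  rw [volumeMeasure_apply_of_subset (isBilinearField_metricForm gN) hφm (himg k) hφt,
    paramVolume_apply _ _ (himg k), hpre]
  refine setLIntegral_congr_fun (measurableSet_source_inter_preimage e.symm (hDm k)) fun z hz => ?_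
  have hb := bijective_modelDeriv (mdifferentiable_chart_symm (s k)) hz.1
  have hG := paramGram_metricForm_det_pos gM hb
  have hP : paramGram (pullback (𝓡 n) (𝓡 n) h (metricForm gN)) e.symm z =
      paramGram (metricForm gN) φ z :=
    paramGram_pullback (h.contMDiff.mdifferentiableAt (by simp))
      ((mdifferentiable_chart_symm (s k)).mdifferentiableAt hz.1)
  rw [volRatio_eq_paramGram (isBilinearField_metricForm gM)
    (isBilinearField_pullback (isBilinearField_metricForm gN) h) hb, hP,
    ← ENNReal.ofReal_mul (Real.sqrt_nonneg _), matVolRatio, ← Real.sqrt_mul hG.le,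
    mul_div_cancel₀ _ hG.ne']

end Volume

/-! ### Variations and critical points -/

section Critical

variable {n : ℕ} {M : Type*} [TopologicalSpace M] [ChartedSpace (EuclideanSpace ℝ (Fin n)) M]

local notation "Eu" => EuclideanSpace ℝ (Fin n)

/-- The local regularity of a family `F t` of functions on `M`: in the chart at each point, and for
the times in `(-ε, ε)`, the family is of class `C^1` in time and space. -/
def IsC1Family (ε : ℝ) (F : ℝ → M → ℝ) : Prop :=
  ∀ t₀ ∈ Ioo (-ε) ε, ∀ p : M, ContDiffAt ℝ 1 (fun q : ℝ × Eu => F q.1 ((chartAt Eu p).symm q.2))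
    (t₀, chartAt Eu p p)

theorem IsC1Family.continuous {ε : ℝ} {F : ℝ → M → ℝ} (hF : IsC1Family (n := n) ε F) {t : ℝ}
    (ht : t ∈ Ioo (-ε) ε) : Continuous (F t) := by
  rw [continuous_iff_continuousAt]
  intro p
  have h1 : ContinuousAt (fun z : Eu => F t ((chartAt Eu p).symm z)) (chartAt Eu p p) :=
    ContinuousAt.comp (f := fun z : Eu => (t, z)) (hF t ht p).continuousAt
      (continuousAt_const.prodMk continuousAt_id)
  have h2 : ContinuousAt (fun q => F t ((chartAt Eu p).symm (chartAt Eu p q))) p :=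
    ContinuousAt.comp (f := chartAt Eu p) h1
      ((chartAt Eu p).continuousAt (mem_chart_source Eu p))
  refine h2.congr ?_
  filter_upwards [(chartAt Eu p).open_source.mem_nhds (mem_chart_source Eu p)] with q hq
  rw [(chartAt Eu p).left_inv hq]

/-- On a compact manifold, a `C^1` family of functions is Lipschitz in time near `t = 0`, uniformly
in space. -/
theorem IsC1Family.exists_lipschitzOnWith [CompactSpace M] {ε : ℝ} (hε : 0 < ε) {F : ℝ → M → ℝ}
    (hF : IsC1Family (n := n) ε F) :
    ∃ s ∈ nhds (0 : ℝ), ∃ K : NNReal, ∀ p, LipschitzOnWith K (F · p) s := by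
  have hloc : ∀ p : M, ∃ U ∈ nhds p, ∃ s ∈ nhds (0 : ℝ), ∃ K : NNReal, ∀ q ∈ U,
      LipschitzOnWith K (F · q) s := fun p => by
    obtain ⟨K, t, ht, hK⟩ := (hF 0 ⟨by linarith, hε⟩ p).exists_lipschitzOnWith
    obtain ⟨s, hs, V, hV, hsV⟩ := mem_nhds_prod_iff.1 ht
    have hc := (chartAt Eu p).continuousAt (mem_chart_source Eu p)
    refine ⟨_, Filter.inter_mem ((chartAt Eu p).open_source.mem_nhds (mem_chart_source Eu p))
      (hc.preimage_mem_nhds hV), s, hs, K, fun q hq => ?_⟩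
    have h1 := LipschitzOnWith.comp (f := fun a : ℝ => (a, chartAt Eu p q)) hK
      ((LipschitzWith.prodMk_right (chartAt Eu p q)).lipschitzOnWith (s := s))
      (fun a ha => hsV ⟨ha, hq.2⟩)
    simpa [Function.comp_def, (chartAt Eu p).left_inv hq.1] using h1
  choose U hU s hs K hK using hloc
  obtain ⟨T, -, hT⟩ := isCompact_univ.elim_nhds_subcover U fun p _ => hU p
  refine ⟨⋂ p ∈ T, s p, (Filter.biInter_finset_mem T).2 fun p _ => hs p, T.sup K, fun q => ?_⟩
  obtain ⟨p, hpT, hq⟩ := mem_iUnion₂.1 (hT (mem_univ q))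
  exact ((hK p q hq).mono (biInter_subset_of_mem hpT)).weaken (Finset.le_sup hpT)

/-- Differentiation under the integral sign for a `C^1` family with vanishing derivative. -/
theorem IsC1Family.hasDerivAt_integral [T2Space M] [CompactSpace M] [MeasurableSpace M]
    [BorelSpace M] {μ : Measure M} [IsFiniteMeasure μ] {ε : ℝ} (hε : 0 < ε) {F : ℝ → M → ℝ}
    (hF : IsC1Family (n := n) ε F) (h0 : ∀ p, HasDerivAt (F · p) 0 0) :
    HasDerivAt (fun t => ∫ p, F t p ∂μ) 0 0 := by
  obtain ⟨s, hs, K, hK⟩ := hF.exists_lipschitzOnWith hε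
  have hI : Ioo (-ε) ε ∈ nhds (0 : ℝ) := Ioo_mem_nhds (by linarith) hε
  have hint : Integrable (F 0) μ := by
    have hc := hF.continuous (mem_of_mem_nhds hI)
    rw [← integrableOn_univ]
    exact hc.continuousOn.integrableOn_compact isCompact_univ
  have := (hasDerivAt_integral_of_dominated_loc_of_lip (μ := μ) (F := F) (F' := fun _ => 0)
    (bound := fun _ => K) hs
    (Filter.mem_of_superset hI fun t ht => (hF.continuous ht).aestronglyMeasurable) hint
    aestronglyMeasurable_const
    (Filter.Eventually.of_forall fun p => by simpa using hK p) (integrable_const _)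
    (Filter.Eventually.of_forall h0)).2
  simpa using this

theorem eventually_snd_mem_chart_target (t₀ : ℝ) (p : M) :
    ∀ᶠ q : ℝ × Eu in nhds (t₀, chartAt Eu p p), q.2 ∈ (chartAt Eu p).symm.source :=
  continuousAt_snd.eventually ((chartAt Eu p).open_target.mem_nhds (mem_chart_target Eu p))

variable {N : Type*} [TopologicalSpace N] [ChartedSpace (EuclideanSpace ℝ (Fin n)) N]

theorem bijective_modelDeriv_diffeo_comp (h : Diff n M N) {φ : OpenPartialHomeomorph Eu M}
    (hφ : φ.MDifferentiable (𝓡 n) (𝓡 n)) {z : Eu} (hz : z ∈ φ.source) :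
    Function.Bijective (modelDeriv (n := n) (h ∘ φ) z) :=
  bijective_modelDeriv (φ := φ.trans h.toHomeomorph.toOpenPartialHomeomorph)
    (hφ.trans (h.toOpenPartialHomeomorph_mdifferentiable (by simp))) (by simpa using hz)

variable [IsManifold (𝓡 n) ∞ M] [IsManifold (𝓡 n) ∞ N]

/-- Along a variation `c`, the coefficients of `(c t)^* g_N` in a chart are of class `C^1` in time
and space: they are the products of first derivatives of `c t` in coordinates with the coefficients
of `g_N` along `c t`. -/
theorem IsVariation.contDiffAt_paramGram_pullback {h : Diff n M N} {ε : ℝ} {c : ℝ → Diff n M N}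
    (hc : IsVariation h ε c) (gN : SmoothMetric n N) {t₀ : ℝ} (ht₀ : t₀ ∈ Ioo (-ε) ε) (p : M)
    (i j : Fin n) :
    ContDiffAt ℝ 1 (fun q : ℝ × Eu => paramGram (pullback (𝓡 n) (𝓡 n) (c q.1) (metricForm gN))
      (chartAt Eu p).symm q.2 i j) (t₀, chartAt Eu p p) := by
  obtain ⟨hε, hc0, hcont, hC⟩ := hc
  set φ := (chartAt Eu p).symm with hφ
  set e := chartAt Eu (c t₀ p) with he
  set u : ℝ × Eu → Eu := fun q => e (c q.1 (φ q.2)) with hu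
  have hz₀ : chartAt Eu p p ∈ φ.source := mem_chart_target Eu p
  have hφz₀ : φ (chartAt Eu p p) = p := (chartAt Eu p).left_inv (mem_chart_source Eu p)
  -- the variation in coordinates and its first spatial derivatives
  have hu0 : ContDiffAt ℝ 1 u (t₀, chartAt Eu p p) := by
    have h1 := hC t₀ ht₀ p 0
    exact (continuousMultilinearCurryFin0 ℝ Eu Eu).toContinuousLinearEquiv.contDiff.contDiffAt.comp
      (t₀, chartAt Eu p p) h1
  have hu1 : ∀ i k, ContDiffAt ℝ 1
      (fun q : ℝ × Eu => stdMatrix (fderiv ℝ (fun z => u (q.1, z)) q.2) i k)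
      (t₀, chartAt Eu p p) := fun i k => by
    have h1 := hC t₀ ht₀ p 1
    have h2 := (ContinuousMultilinearMap.apply ℝ (fun _ : Fin 1 => Eu) Eu
      (fun _ => EuclideanSpace.single k (1 : ℝ))).contDiff.contDiffAt.comp (t₀, chartAt Eu p p) h1
    have h3 := (EuclideanSpace.proj (𝕜 := ℝ) i : Eu →L[ℝ] ℝ).contDiff.contDiffAt.comp
      (t₀, chartAt Eu p p) h2
    refine h3.congr_of_eventuallyEq (Filter.Eventually.of_forall fun q => ?_)
    simp [stdMatrix, iteratedFDeriv_one_apply, hu]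
    rfl
  -- the coefficients of the metric of `N` along the variation
  have hu_pt : u (t₀, chartAt Eu p p) = e (c t₀ p) := by simp only [hu, hφz₀]
  have hH : ∀ i k, ContDiffAt ℝ 1 (fun q : ℝ × Eu => paramGram (metricForm gN) e.symm (u q) i k)
      (t₀, chartAt Eu p p) := fun i k => by
    refine ContDiffAt.comp (g := fun w => paramGram (metricForm gN) e.symm w i k) _ ?_ hu0
    rw [hu_pt]
    exact contDiffAt_paramGram_metricForm gN _ (mem_chart_target Eu (c t₀ p)) i k
  have hprod := contDiffAt_matrix_mul (contDiffAt_matrix_mul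
    (A := fun q : ℝ × Eu => (stdMatrix (fderiv ℝ (fun z => u (q.1, z)) q.2)).transpose)
    (fun i k => hu1 k i) hH) hu1 i j
  refine hprod.congr_of_eventuallyEq ?_
  -- points near `(t₀, p)` stay in the chart domains
  have hU : ∀ᶠ q : ℝ × Eu in nhds (t₀, chartAt Eu p p), q.2 ∈ φ.source ∧
      c q.1 (φ q.2) ∈ e.source := by
    have h1 : ∀ᶠ q : ℝ × Eu in nhds (t₀, chartAt Eu p p), q.2 ∈ φ.source :=
      continuousAt_snd.eventually (φ.open_source.mem_nhds hz₀)
    have h2 : ContinuousAt (fun q : ℝ × M => c q.1 q.2) (t₀, φ (chartAt Eu p p)) :=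
      hcont.continuousAt (prod_mem_nhds (Ioo_mem_nhds ht₀.1 ht₀.2) Filter.univ_mem)
    have h3 : ContinuousAt (fun q : ℝ × Eu => c q.1 (φ q.2)) (t₀, chartAt Eu p p) :=
      ContinuousAt.comp (x := (t₀, chartAt Eu p p)) (f := fun q : ℝ × Eu => (q.1, φ q.2))
        (g := fun q : ℝ × M => c q.1 q.2) h2
        (continuousAt_fst.prodMk (ContinuousAt.comp (x := (t₀, chartAt Eu p p)) (f := Prod.snd)
          (φ.continuousAt hz₀) continuousAt_snd))
    refine h1.and (h3.eventually (e.open_source.mem_nhds ?_))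
    simpa only [hφz₀] using mem_chart_source Eu (c t₀ p)
  filter_upwards [hU.eventually_nhds] with q hq
  obtain ⟨hqs, hqe⟩ := hq.self_of_nhds
  have hφd := mdifferentiable_chart_symm (n := n) p
  have hmd : MDifferentiableAt (𝓡 n) (𝓡 n) (c q.1) (φ q.2) :=
    (c q.1).contMDiff.mdifferentiableAt (by simp)
  rw [paramGram_pullback hmd (hφd.mdifferentiableAt hqs)]
  have hev : c q.1 ∘ φ =ᶠ[nhds q.2] e.symm ∘ fun z => u (q.1, z) := by
    have : ∀ᶠ z in nhds q.2, c q.1 (φ z) ∈ e.source :=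
      (Continuous.prodMk_right q.1).continuousAt.eventually (hq.mono fun _ h => h.2)
    filter_upwards [this] with z hz
    exact (e.left_inv hz).symm
  have hed := mdifferentiable_chart_symm (n := n) (c t₀ p)
  have hud : DifferentiableAt ℝ (fun z => u (q.1, z)) q.2 :=
    ((hed.mdifferentiableAt_symm hqe).comp q.2 (hmd.comp q.2
      (hφd.mdifferentiableAt hqs))).differentiableAt
  rw [paramGram_eq_of_eventuallyEq (isBilinearField_metricForm gN) hev
    (hed.mdifferentiableAt (e.map_source hqe)) hud]

theorem contDiffAt_paramGram_metricForm_snd (gM : SmoothMetric n M) (t₀ : ℝ) (p : M) (i j : Fin n) :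
    ContDiffAt ℝ 1 (fun q : ℝ × Eu => paramGram (metricForm gM) (chartAt Eu p).symm q.2 i j)
      (t₀, chartAt Eu p p) :=
  ContDiffAt.comp (f := Prod.snd)
    (g := fun z => paramGram (metricForm gM) (chartAt Eu p).symm z i j) _
    (contDiffAt_paramGram_metricForm gM p (mem_chart_target Eu p) i j) contDiffAt_snd

theorem paramGram_metricForm_chart_det_pos (gM : SmoothMetric n M) (p : M) :
    0 < (paramGram (metricForm gM) (chartAt Eu p).symm (chartAt Eu p p)).det :=
  paramGram_metricForm_det_pos gM
    (bijective_modelDeriv (mdifferentiable_chart_symm p) (mem_chart_target Eu p))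

theorem IsVariation.isC1Family_tensorNormSq {h : Diff n M N} {ε : ℝ} {c : ℝ → Diff n M N}
    (hc : IsVariation h ε c) (gM : SmoothMetric n M) (gN : SmoothMetric n N) :
    IsC1Family (n := n) ε (fun t => tensorNormSq (metricForm gM)
      (fun p v w => pullback (𝓡 n) (𝓡 n) (c t) (metricForm gN) p v w - metricForm gM p v w)) := by
  intro t₀ ht₀ p
  have hG := contDiffAt_paramGram_metricForm_snd gM t₀ p
  have h1 := contDiffAt_matNormSq hG
    (contDiffAt_matrix_sub (hc.contDiffAt_paramGram_pullback gN ht₀ p) hG)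
    (paramGram_metricForm_chart_det_pos gM p).ne'
  refine h1.congr_of_eventuallyEq ?_
  filter_upwards [eventually_snd_mem_chart_target t₀ p] with q hq
  have hbM := isBilinearField_metricForm gM
  have hbN := isBilinearField_pullback (isBilinearField_metricForm gN) (c q.1)
  rw [tensorNormSq_eq_paramGram hbM (hbN.sub hbM)
    (bijective_modelDeriv (mdifferentiable_chart_symm p) hq), paramGram_sub]

theorem IsVariation.isC1Family_volRatio {h : Diff n M N} {ε : ℝ} {c : ℝ → Diff n M N}
    (hc : IsVariation h ε c) (gM : SmoothMetric n M) (gN : SmoothMetric n N) :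
    IsC1Family (n := n) ε (fun t =>
      volRatio (metricForm gM) (pullback (𝓡 n) (𝓡 n) (c t) (metricForm gN))) := by
  intro t₀ ht₀ p
  have hd := mdifferentiable_chart_symm (n := n) p
  have hz : chartAt Eu p p ∈ (chartAt Eu p).symm.source := mem_chart_target Eu p
  have hpos : 0 < (paramGram (pullback (𝓡 n) (𝓡 n) (c t₀) (metricForm gN)) (chartAt Eu p).symm
      (chartAt Eu p p)).det := by
    rw [paramGram_pullback ((c t₀).contMDiff.mdifferentiableAt (by simp)) (hd.mdifferentiableAt hz)]
    exact paramGram_metricForm_det_pos gN (bijective_modelDeriv_diffeo_comp (c t₀) hd hz)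
  have h1 := contDiffAt_matVolRatio (contDiffAt_paramGram_metricForm_snd gM t₀ p)
    (hc.contDiffAt_paramGram_pullback gN ht₀ p) (paramGram_metricForm_chart_det_pos gM p) hpos
  refine h1.congr_of_eventuallyEq ?_
  filter_upwards [eventually_snd_mem_chart_target t₀ p] with q hq
  exact volRatio_eq_paramGram (isBilinearField_metricForm gM)
    (isBilinearField_pullback (isBilinearField_metricForm gN) (c q.1))
    (bijective_modelDeriv (mdifferentiable_chart_symm p) hq)

/-- If `h^* g_N = R² g_M`, then `‖(c t)^* g_N - g_M‖²` and a suitable multiple of the volume ratio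
have the same derivative at time `0` along a variation `c` of `h`, at every point. -/
theorem IsVariation.hasDerivAt_calibrated {h : Diff n M N} {ε : ℝ} {c : ℝ → Diff n M N}
    (hc : IsVariation h ε c) (gM : SmoothMetric n M) (gN : SmoothMetric n N) {R : ℝ} (hR : R ≠ 0)
    (hh : ∀ (p : M) (v w : TangentSpace (𝓡 n) p),
      pullback (𝓡 n) (𝓡 n) h (metricForm gN) p v w = R ^ 2 * metricForm gM p v w) (p : M) :
    HasDerivAt (fun t => tensorNormSq (metricForm gM) (fun p v w =>
        pullback (𝓡 n) (𝓡 n) (c t) (metricForm gN) p v w - metricForm gM p v w) p -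
      4 * (R ^ 2 - 1) * (R ^ 2 / |R| ^ n) *
        volRatio (metricForm gM) (pullback (𝓡 n) (𝓡 n) (c t) (metricForm gN)) p) 0 0 := by
  set φ := (chartAt Eu p).symm with hφ
  set z := chartAt Eu p p with hz
  have hφz : φ z = p := (chartAt Eu p).left_inv (mem_chart_source Eu p)
  have hb := bijective_modelDeriv (mdifferentiable_chart_symm p) (mem_chart_target Eu p)
  have hbM := isBilinearField_metricForm gM
  have hbN := fun t => isBilinearField_pullback (isBilinearField_metricForm gN) (c t)
  have h0 : (0 : ℝ) ∈ Ioo (-ε) ε := ⟨by linarith [hc.1], hc.1⟩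
  have hP : ∀ i j, DifferentiableAt ℝ (fun t => paramGram (pullback (𝓡 n) (𝓡 n) (c t)
      (metricForm gN)) φ z i j) 0 := fun i j =>
    DifferentiableAt.comp (f := fun t : ℝ => (t, z)) (0 : ℝ)
      ((hc.contDiffAt_paramGram_pullback gN h0 p i j).differentiableAt (by simp))
      (differentiableAt_id.prodMk (differentiableAt_const z))
  have hP0 : paramGram (pullback (𝓡 n) (𝓡 n) (c 0) (metricForm gN)) φ z =
      R ^ 2 • paramGram (metricForm gM) φ z := by
    rw [hc.2.1]
    ext i j
    exact hh _ _ _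
  have key := hasDerivAt_matCalibrated hR (paramGram_metricForm_det_pos gM hb)
    (paramGram_metricForm_transpose gM φ z) (P' := Matrix.of fun i j => deriv (fun t => paramGram
      (pullback (𝓡 n) (𝓡 n) (c t) (metricForm gN)) φ z i j) 0) (fun i j => (hP i j).hasDerivAt) hP0
  refine key.congr_of_eventuallyEq (Filter.Eventually.of_forall fun t => ?_)
  have h1 := tensorNormSq_eq_paramGram hbM ((hbN t).sub hbM) hb
  have h2 := volRatio_eq_paramGram hbM (hbN t) hb
  rw [← hφ, ← hz, hφz] at h1 h2
  simp only [h1, h2]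
  rfl

variable [CompactSpace M] [Nonempty M] [MeasurableSpace M] [BorelSpace M]

/-- Both integrals are the volume of `N`. -/
theorem integral_volRatio_pullback_eq (gM : SmoothMetric n M) (gN : SmoothMetric n N)
    (h h' : Diff n M N)
    (hh : Continuous (volRatio (metricForm gM) (pullback (𝓡 n) (𝓡 n) h (metricForm gN))))
    (hh' : Continuous (volRatio (metricForm gM) (pullback (𝓡 n) (𝓡 n) h' (metricForm gN)))) :
    ∫ p, volRatio (metricForm gM) (pullback (𝓡 n) (𝓡 n) h (metricForm gN)) p
        ∂volumeMeasure (metricForm gM) =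
      ∫ p, volRatio (metricForm gM) (pullback (𝓡 n) (𝓡 n) h' (metricForm gN)) p
        ∂volumeMeasure (metricForm gM) := by
  let : MeasurableSpace N := borel N
  have : BorelSpace N := ⟨rfl⟩
  rw [integral_eq_lintegral_of_nonneg_ae
      (Filter.Eventually.of_forall fun p => volRatio_nonneg _ _ p) hh.aestronglyMeasurable,
    integral_eq_lintegral_of_nonneg_ae
      (Filter.Eventually.of_forall fun p => volRatio_nonneg _ _ p) hh'.aestronglyMeasurable,
    lintegral_volRatio_pullback gM gN h hh.measurable,
    lintegral_volRatio_pullback gM gN h' hh'.measurable]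

variable [T2Space M]

theorem isCriticalPoint_of_pullback_eq_of_ne_zero (gM : SmoothMetric n M) (gN : SmoothMetric n N)
    (h : Diff n M N) {R : ℝ} (hR : R ≠ 0)
    (hh : ∀ (p : M) (v w : TangentSpace (𝓡 n) p),
      pullback (𝓡 n) (𝓡 n) h (metricForm gN) p v w = R ^ 2 * metricForm gM p v w) :
    IsCriticalPoint gM gN h := by
  intro ε c hc
  have hE := hc.isC1Family_tensorNormSq gM gN
  have hJ := hc.isC1Family_volRatio gM gN
  set μ := volumeMeasure (metricForm gM) with hμ
  set a : ℝ := 4 * (R ^ 2 - 1) * (R ^ 2 / |R| ^ n) with ha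
  set J : ℝ → M → ℝ := fun t =>
    volRatio (metricForm gM) (pullback (𝓡 n) (𝓡 n) (c t) (metricForm gN)) with hJdef
  have hF : IsC1Family (n := n) ε (fun t p => tensorNormSq (metricForm gM)
      (fun p v w => pullback (𝓡 n) (𝓡 n) (c t) (metricForm gN) p v w - metricForm gM p v w) p -
      a * J t p) := fun t₀ ht₀ p => (hE t₀ ht₀ p).sub (contDiffAt_const.mul (hJ t₀ ht₀ p))
  have hd := (hF.hasDerivAt_integral (μ := μ) hc.1
    (hc.hasDerivAt_calibrated gM gN hR hh)).add_const (a * ∫ p, J 0 p ∂μ)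
  have hI : Ioo (-ε) ε ∈ nhds (0 : ℝ) := Ioo_mem_nhds (by linarith [hc.1]) hc.1
  refine hd.congr_of_eventuallyEq ?_
  filter_upwards [hI] with t ht
  have hint : ∀ {f : M → ℝ}, Continuous f → Integrable f μ := fun hf => by
    rw [← integrableOn_univ]
    exact hf.continuousOn.integrableOn_compact isCompact_univ
  rw [integral_sub (hint (hE.continuous ht)) ((hint (hJ.continuous ht)).const_mul a),
    integral_const_mul, integral_volRatio_pullback_eq gM gN (c 0) (c t)
      (hJ.continuous (mem_of_mem_nhds hI)) (hJ.continuous ht), sub_add_cancel]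
  rfl

/-- A homothetic diffeomorphism is a critical point. The factor can vanish only in dimension `0`,
where it may be replaced by `1`. -/
theorem isCriticalPoint_of_pullback_eq (gM : SmoothMetric n M) (gN : SmoothMetric n N)
    (h : Diff n M N) (R : ℝ)
    (hh : ∀ (p : M) (v w : TangentSpace (𝓡 n) p),
      pullback (𝓡 n) (𝓡 n) h (metricForm gN) p v w = R ^ 2 * metricForm gM p v w) :
    IsCriticalPoint gM gN h := by
  by_cases hR : R = 0
  · refine isCriticalPoint_of_pullback_eq_of_ne_zero gM gN h one_ne_zero fun p v w => ?_
    have hv : v = 0 := by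
      by_contra hv
      have h1 : mfderiv (𝓡 n) (𝓡 n) h p v ≠ 0 := fun h0 => hv <|
        (h.toOpenPartialHomeomorph_mdifferentiable (by simp)).mfderiv_injective (mem_univ p)
          (h0.trans (map_zero _).symm)
      have h2 := gN.pos _ _ h1
      have h3 := hh p v v
      rw [hR] at h3
      simp only [pullback, metricForm] at h3
      rw [h3] at h2
      simp at h2
    have h1 := hh p v w
    subst hv
    rw [h1]
    simp [metricForm]
  · exact isCriticalPoint_of_pullback_eq_of_ne_zero gM gN h hR hh

end Critical

/-! ### Embedded manifolds -/

section Embedded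

variable {n : ℕ} {M : Type*} [TopologicalSpace M] [ChartedSpace (EuclideanSpace ℝ (Fin n)) M]
  {N : Type*} [TopologicalSpace N] [ChartedSpace (EuclideanSpace ℝ (Fin n)) N]

/-- A map into an embedded manifold is smooth as soon as it is smooth as a map into the ambient
space. -/
theorem contMDiff_of_comp_isSmoothEmbedding {m : ℕ} {u : N → EuclideanSpace ℝ (Fin m)}
    (hu : Manifold.IsSmoothEmbedding (𝓡 n) (𝓡 m) ∞ u) {f : M → N}
    (hf : ContMDiff (𝓡 n) (𝓡 m) ∞ (u ∘ f)) : ContMDiff (𝓡 n) (𝓡 n) ∞ f :=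
  (ContMDiff.iff_comp_isImmersion hu.isImmersion).2
    ⟨hu.isEmbedding.continuous_iff.2 hf.continuous, hf⟩

/-- A bijection between embedded manifolds that is the restriction of a homothety of the ambient
space is a diffeomorphism. -/
theorem exists_diff_of_range_eq_smul {m : ℕ} {u : M → EuclideanSpace ℝ (Fin m)}
    {v : N → EuclideanSpace ℝ (Fin m)} (hu : Manifold.IsSmoothEmbedding (𝓡 n) (𝓡 m) ∞ u)
    (hv : Manifold.IsSmoothEmbedding (𝓡 n) (𝓡 m) ∞ v) {R : ℝ} (hR : R ≠ 0)
    (hr : range v = (fun x => R • x) '' range u) :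
    ∃ h : Diff n M N, ∀ p, v (h p) = R • u p := by
  have h1 : ∀ p, ∃ q, v q = R • u p := fun p => by
    have : R • u p ∈ range v := hr ▸ mem_image_of_mem _ (mem_range_self p)
    exact this
  have h2 : ∀ q, ∃ p, u p = R⁻¹ • v q := fun q => by
    have : v q ∈ (fun x => R • x) '' range u := hr ▸ mem_range_self q
    obtain ⟨_, ⟨p, rfl⟩, hp⟩ := this
    exact ⟨p, by rw [← hp, inv_smul_smul₀ hR]⟩
  choose f hf using h1
  choose g hg using h2
  refine ⟨⟨⟨f, g, fun p => hu.isEmbedding.injective ?_, fun q => hv.isEmbedding.injective ?_⟩,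
    ?_, ?_⟩, hf⟩
  · rw [hg, hf, inv_smul_smul₀ hR]
  · rw [hf, hg, smul_inv_smul₀ hR]
  · refine contMDiff_of_comp_isSmoothEmbedding hv ?_
    have : v ∘ f = fun p => R • u p := funext hf
    change ContMDiff _ _ _ (v ∘ f)
    rw [this]
    exact (contDiff_const_smul R).contMDiff.comp hu.contMDiff
  · refine contMDiff_of_comp_isSmoothEmbedding hu ?_
    have : u ∘ g = fun q => R⁻¹ • v q := funext hg
    change ContMDiff _ _ _ (u ∘ g)
    rw [this]
    exact (contDiff_const_smul R⁻¹).contMDiff.comp hv.contMDiff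

variable [IsManifold (𝓡 n) ∞ N]

/-- Composition with an isometry of `N` does not change the pull-back of the metric. -/
theorem pullback_trans_of_isometry {gN : SmoothMetric n N} (h : Diff n M N) (f : Diff n N N)
    (hf : pullback (𝓡 n) (𝓡 n) f (metricForm gN) = metricForm gN) :
    pullback (𝓡 n) (𝓡 n) (h.trans f) (metricForm gN) =
      pullback (𝓡 n) (𝓡 n) h (metricForm gN) := by
  conv_rhs => rw [← hf]
  funext p v w
  have h1 : mfderiv (𝓡 n) (𝓡 n) (f ∘ h) p = (mfderiv (𝓡 n) (𝓡 n) f (h p)).comp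
      (mfderiv (𝓡 n) (𝓡 n) h p) := mfderiv_comp p (f.contMDiff.mdifferentiableAt (by simp))
    (h.contMDiff.mdifferentiableAt (by simp))
  change metricForm gN (f (h p)) (mfderiv (𝓡 n) (𝓡 n) (f ∘ h) p v)
    (mfderiv (𝓡 n) (𝓡 n) (f ∘ h) p w) = _
  rw [h1]
  rfl

variable [IsManifold (𝓡 n) ∞ M]

/-- For the metrics inherited from the ambient space, a map that restricts the homothety of ratio
`R` multiplies the metric by `R²`. -/
theorem pullback_metricForm_of_smul {m : ℕ} {gM : SmoothMetric n M} {gN : SmoothMetric n N}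
    {u : M → EuclideanSpace ℝ (Fin m)} {v : N → EuclideanSpace ℝ (Fin m)}
    (hu : IsIsometricEmbedding gM u) (hv : IsIsometricEmbedding gN v) {R : ℝ} (h : Diff n M N)
    (hh : ∀ p, v (h p) = R • u p) (p : M) (a b : TangentSpace (𝓡 n) p) :
    pullback (𝓡 n) (𝓡 n) h (metricForm gN) p a b = R ^ 2 * metricForm gM p a b := by
  have hud : MDifferentiableAt (𝓡 n) (𝓡 m) u p := hu.1.contMDiff.mdifferentiableAt (by simp)
  have hvd : MDifferentiableAt (𝓡 n) (𝓡 m) v (h p) := hv.1.contMDiff.mdifferentiableAt (by simp)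
  have hhd : MDifferentiableAt (𝓡 n) (𝓡 n) h p := h.contMDiff.mdifferentiableAt (by simp)
  have hcomp : v ∘ h = R • u := funext hh
  have h1 : ∀ a : TangentSpace (𝓡 n) p,
      (mfderiv (𝓡 n) (𝓡 m) v (h p) (mfderiv (𝓡 n) (𝓡 n) h p a) : EuclideanSpace ℝ (Fin m)) =
        R • (mfderiv (𝓡 n) (𝓡 m) u p a : EuclideanSpace ℝ (Fin m)) := fun a => by
    have h2 := mfderiv_comp p hvd hhd
    have h3 := (hud.hasMFDerivAt.const_smul R).mfderiv
    rw [hcomp, h3] at h2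
    exact (congrArg (fun L : EuclideanSpace ℝ (Fin n) →L[ℝ] EuclideanSpace ℝ (Fin m) => L a)
      h2).symm
  rw [hu.2, hv.2]
  simp only [pullback, euclideanMetric]
  rw [h1, h1]
  have h2 : ∀ x y : EuclideanSpace ℝ (Fin m), inner ℝ (R • x) (R • y) = R ^ 2 * inner ℝ x y :=
    fun x y => by rw [real_inner_smul_left, real_inner_smul_right]; ring
  exact h2 _ _

end Embedded

end Deformation

theorem mainTheorem6 {n : ℕ} {M N : Type*}
    [TopologicalSpace M] [ChartedSpace (EuclideanSpace ℝ (Fin n)) M] [IsManifold (𝓡 n) ∞ M]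
    [T2Space M] [CompactSpace M] [ConnectedSpace M] [MeasurableSpace M] [BorelSpace M]
    [TopologicalSpace N] [ChartedSpace (EuclideanSpace ℝ (Fin n)) N] [IsManifold (𝓡 n) ∞ N]
    (gM : Deformation.SmoothMetric n M) (gN : Deformation.SmoothMetric n N) :
    -- a diffeomorphism with `h^* g_N = R² g_M` is a critical point
    (∀ (h : Deformation.Diff n M N) (R : ℝ),
      (∀ (p : M) (v w : TangentSpace (𝓡 n) p),
        Deformation.pullback (𝓡 n) (𝓡 n) h (Deformation.metricForm gN) p v w =
          R ^ 2 * Deformation.metricForm gM p v w) →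
      Deformation.IsCriticalPoint gM gN h) ∧
    -- if `M` and `N` are hypersurfaces of `ℝ^{n+1}` with the inherited metrics and `N = R M`, then
    -- the radial map is a diffeomorphism and its compositions with isometries are critical points
    (∀ (ιM : M → EuclideanSpace ℝ (Fin (n + 1))) (ιN : N → EuclideanSpace ℝ (Fin (n + 1))) (R : ℝ),
      0 < R →
      Deformation.IsIsometricEmbedding gM ιM → Deformation.IsIsometricEmbedding gN ιN →
      Set.range ιN = (fun x => R • x) '' Set.range ιM →
      ∃ hR : Deformation.Diff n M N,
        (∀ p : M, ιN (hR p) = R • ιM p) ∧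
        ∀ f : Deformation.Diff n N N,
          Deformation.pullback (𝓡 n) (𝓡 n) f (Deformation.metricForm gN) =
            Deformation.metricForm gN →
          Deformation.IsCriticalPoint gM gN (hR.trans f)) := by
  refine ⟨Deformation.isCriticalPoint_of_pullback_eq gM gN, fun ιM ιN R hR hM hN hr => ?_⟩
  obtain ⟨hd, hdR⟩ := Deformation.exists_diff_of_range_eq_smul hM.1 hN.1 hR.ne' hr
  refine ⟨hd, hdR, fun f hf => ?_⟩
  refine Deformation.isCriticalPoint_of_pullback_eq gM gN (hd.trans f) R fun p v w => ?_
  rw [Deformation.pullback_trans_of_isometry hd f hf]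
  exact Deformation.pullback_metricForm_of_smul hM hN hd hdR p v w
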